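/- Let $G$ be a second-countable, unimodular, locally compact (Hausdorff) group with Haar measure $\mu$. A strong Følner sequence is a sequence $(K_n)$ of non-null compact subsets of $G$ such that, for every non-empty compact $C\subseteq G$, $\mu(K_nC\,\triangle\,K_n)/\mu(K_n)\to 0$ and $\mu(K_nC\cap K_n^cC)/\mu(K_n)\to 0$. Fix a strong Følner sequence $(K_n)$ (so $G$ is amenable) with $K_n\subseteq K_{n+1}$ and $\bigcup_n K_n=G$, and a compact symmetric unit neighbourhood $Q\subseteq G$. Let $\pi$ be a discrete series representation of $G$ on a complex Hilbert space $\mathcal H$, i.e. an irreducible strongly measurable projective unitary representation, $\pi(xy)=\sigma(x,y)\pi(x)\pi(y)$ with $\sigma:G\times G\to\mathbb T$, such that $\int_G|\langle u,\pi(x)u\rangle|^2\,d\mu(x)<\infty$ for some $u\neq 0$. Its formal degree $d_\pi>0$ is the number with $$\int_G\langle f_1,\pi(x)g_1\rangle\langle\pi(x)g_2,f_2\rangle\,d\mu(x)=d_\pi^{-1}\langle f_1,f_2\rangle\overline{\langle g_1,g_2\rangle}\qquad(f_1,f_2,g_1,g_2\in\mathcal H).$$ Let $g\in\mathcal B^2_\pi$,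 i.e. the function $V_gg(x)=\langle g,\pi(x)g\rangle$ satisfies $\int_G \operatorname{ess\,sup}_{z\in Q}|V_gg(xz)|^2\,d\mu(x)<\infty$. Let $\Lambda\subseteq G$ be discrete and suppose that $\pi(\Lambda)g=(\pi(\lambda)g)_{\lambda\in\Lambda}$ is a frame for $\mathcal H$, with frame operator $Sf=\sum_{\lambda\in\Lambda}\langle f,\pi(\lambda)g\rangle\pi(\lambda)g$ and canonical dual frame $h_\lambda=S^{-1}\pi(\lambda)g$. Then the formal degree $d_\pi$ exists; the lower and upper Beurling densities $$D^-(\Lambda)=\lim_{n\to\infty}\inf_{x\in G}\frac{\#(\Lambda\cap xL_n)}{\mu(L_n)},\qquad D^+(\Lambda)=\lim_{n\to\infty}\sup_{x\in G}\frac{\#(\Lambda\cap xL_n)}{\mu(L_n)}$$ exist for every strong Følner sequence $(L_n)$, do not depend on it, and satisfy $0<D^-(\Lambda)\le D^+(\Lambda)<\infty$; and the lower and upper frame measures $$M^-=\lim_{n\to\infty}\inf_{x\in G}\frac1{\#(\Lambda\cap xK_n)}\sum_{\lambda\in\Lambda\cap xK_n}\langle\pi(\lambda)g,h_\lambda\rangle,\qquad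 M^+=\lim_{n\to\infty}\sup_{x\in G}\frac1{\#(\Lambda\cap xK_n)}\sum_{\lambda\in\Lambda\cap xK_n}\langle\pi(\lambda)g,h_\lambda\rangle$$ exist and satisfy $$M^-=\frac{d_\pi}{D^+(\Lambda)},\qquad M^+=\frac{d_\pi}{D^-(\Lambda)}.$$ -/

import Mathlib

open MeasureTheory Filter Topology
open scoped ENNReal NNReal Pointwise symmDiff ComplexConjugate

noncomputable section

namespace CoherentFrame

/-! Mathlib's `inner ℂ u v` is linear in `v`; the inner product `⟨u, v⟩` that is linear in its
first argument is therefore `inner ℂ v u`. -/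

/-! ### Følner sequences -/

section Folner

variable {G : Type*} [Group G] [TopologicalSpace G] [MeasurableSpace G]

/-- (Right) Følner sequence: non-null compact sets with `μ (Kₙ C ∆ Kₙ) / μ (Kₙ) → 0` for every
(non-empty) compact set `C`. -/
structure IsFolner (μ : Measure G) (K : ℕ → Set G) : Prop where
  isCompact : ∀ n, IsCompact (K n)
  measure_ne_zero : ∀ n, μ (K n) ≠ 0
  tendsto_symmDiff : ∀ C : Set G, IsCompact C → C.Nonempty →
    Tendsto (fun n => μ ((K n * C) ∆ K n) / μ (K n)) atTop (𝓝 0)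

/-- (Right) strong Følner sequence. -/
structure IsStrongFolner (μ : Measure G) (K : ℕ → Set G) : Prop extends IsFolner μ K where
  tendsto_boundary : ∀ C : Set G, IsCompact C →
    Tendsto (fun n => μ ((K n * C) ∩ ((K n)ᶜ * C)) / μ (K n)) atTop (𝓝 0)

/-- The nesting and covering property `Kₙ ⊆ Kₙ₊₁`, `G = ⋃ₙ Kₙ`. -/
def IsNestedCover (K : ℕ → Set G) : Prop :=
  (∀ n, K n ⊆ K (n + 1)) ∧ ⋃ n, K n = Set.univ

/-! ### Beurling densities -/

/-- `D` is the lower Beurling density of `Λ`: for every strong Følner sequence the limit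
of `inf_x #(Λ ∩ x Kₙ) / μ(Kₙ)` exists and equals `D`. -/
def HasLowerBeurlingDensity (μ : Measure G) (Λ : Set G) (D : ℝ≥0∞) : Prop :=
  ∀ K : ℕ → Set G, IsStrongFolner μ K →
    Tendsto (fun n => ⨅ x : G, ((Λ ∩ x • K n).encard : ℝ≥0∞) / μ (K n)) atTop (𝓝 D)

/-- `D` is the upper Beurling density of `Λ`: for every strong Følner sequence the limit
of `sup_x #(Λ ∩ x Kₙ) / μ(Kₙ)` exists and equals `D`. -/
def HasUpperBeurlingDensity (μ : Measure G) (Λ : Set G) (D : ℝ≥0∞) : Prop :=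
  ∀ K : ℕ → Set G, IsStrongFolner μ K →
    Tendsto (fun n => ⨆ x : G, ((Λ ∩ x • K n).encard : ℝ≥0∞) / μ (K n)) atTop (𝓝 D)

/-! ### Wiener amalgam spaces -/

/-- The left-sided local maximal function `M^L F (x) = ess sup_{z ∈ Q} |F (x z)|`. -/
def localMaximal (μ : Measure G) (Q : Set G) (F : G → ℂ) (x : G) : ℝ≥0∞ :=
  essSup (fun z => ‖F (x * z)‖ₑ) (μ.restrict Q)

/-- Membership in the left-sided Wiener amalgam space `W^L(L^p)`: `F` is measurable and locally
essentially bounded, and its local maximal function is `p`-integrable. -/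
structure MemWienerAmalgam (μ : Measure G) (Q : Set G) (p : ℝ) (F : G → ℂ) : Prop where
  aestronglyMeasurable : AEStronglyMeasurable F μ
  locallyBounded : ∀ C : Set G, IsCompact C → essSup (fun x => ‖F x‖ₑ) (μ.restrict C) < ∞
  lintegral_lt_top : ∫⁻ x, localMaximal μ Q F x ^ p ∂μ < ∞

end Folner

/-! ### Frames -/

section Frame

variable {ι H : Type*} [NormedAddCommGroup H] [InnerProductSpace ℂ H]

/-- The family `e` is a frame for `H`. -/
def IsFrame (e : ι → H) : Prop :=
  ∃ A B : ℝ, 0 < A ∧ 0 < B ∧ ∀ f : H,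
    Summable (fun i => ‖inner ℂ (e i) f‖ ^ 2) ∧
    A * ‖f‖ ^ 2 ≤ ∑' i, ‖inner ℂ (e i) f‖ ^ 2 ∧
    ∑' i, ‖inner ℂ (e i) f‖ ^ 2 ≤ B * ‖f‖ ^ 2

/-- The frame operator `S f = ∑ i, ⟨f, e i⟩ e i`. -/
def frameOperator (e : ι → H) (f : H) : H := ∑' i, inner ℂ (e i) f • e i

/-- The canonical dual `h i = S⁻¹ (e i)`; the operator `S` is bijective when `e` is a frame of a
Hilbert space. -/
def canonicalDual (e : ι → H) (i : ι) : H := Function.invFun (frameOperator e) (e i)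

end Frame

/-! ### Projective unitary representations -/

/-- A projective unitary representation: a strongly measurable map `π` into the unitaries of `H`
with `π (x y) = σ (x, y) π x π y` for some function `σ : G × G → 𝕋`. -/
structure ProjectiveRep (G H : Type*) [Group G] [MeasurableSpace G]
    [NormedAddCommGroup H] [InnerProductSpace ℂ H] where
  toFun : G → (H ≃ₗᵢ[ℂ] H)
  stronglyMeasurable : ∀ f : H, StronglyMeasurable (fun x => toFun x f)
  exists_cocycle : ∃ σ : G × G → Circle, ∀ (x y : G) (f : H),
    toFun (x * y) f = (σ (x, y) : ℂ) • toFun x (toFun y f)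

namespace ProjectiveRep

variable {G H : Type*} [Group G] [TopologicalSpace G] [MeasurableSpace G]
  [NormedAddCommGroup H] [InnerProductSpace ℂ H]

instance : CoeFun (ProjectiveRep G H) (fun _ => G → (H ≃ₗᵢ[ℂ] H)) := ⟨ProjectiveRep.toFun⟩

/-- The coefficient transform `V_g f (x) = ⟨f, π(x) g⟩`. -/
def coeff (π : ProjectiveRep G H) (g f : H) (x : G) : ℂ := inner ℂ (π x g) f

/-- The only closed invariant subspaces are `{0}` and `H`. -/
def IsIrreducible (π : ProjectiveRep G H) : Prop :=
  ∀ W : Submodule ℂ H, IsClosed (W : Set H) → (∀ x : G, ∀ f ∈ W, π x f ∈ W) → W = ⊥ ∨ W = ⊤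

/-- Irreducible square-integrable representations. -/
def IsDiscreteSeries (π : ProjectiveRep G H) (μ : Measure G) : Prop :=
  π.IsIrreducible ∧ ∃ g : H, g ≠ 0 ∧ ∫⁻ x, ‖π.coeff g g x‖ₑ ^ 2 ∂μ < ∞

/-- `d > 0` is the formal degree of `π`: for all `f₁ f₂ g₁ g₂`,
`∫ ⟨f₁, π(x) g₁⟩ ⟨π(x) g₂, f₂⟩ dμ(x) = d⁻¹ ⟨f₁, f₂⟩ conj ⟨g₁, g₂⟩`, the integrals being
absolutely convergent. -/
def IsFormalDegree (π : ProjectiveRep G H) (μ : Measure G) (d : ℝ) : Prop :=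
  0 < d ∧ ∀ f₁ f₂ g₁ g₂ : H,
    Integrable (fun x => inner ℂ (π x g₁) f₁ * inner ℂ f₂ (π x g₂)) μ ∧
    ∫ x, inner ℂ (π x g₁) f₁ * inner ℂ f₂ (π x g₂) ∂μ
      = (d : ℂ)⁻¹ * inner ℂ f₂ f₁ * conj (inner ℂ g₂ g₁)

/-- `g ∈ 𝓑²_π`, that is, `V_g g ∈ W^L(L²)`. -/
def MemB2 (π : ProjectiveRep G H) (μ : Measure G) (Q : Set G) (g : H) : Prop :=
  MemWienerAmalgam μ Q 2 (π.coeff g g)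

/-- The coherent system `π(Λ) g = (π(λ) g)_{λ ∈ Λ}`. -/
def coherentSystem (π : ProjectiveRep G H) (Λ : Set G) (g : H) (l : Λ) : H := π l g

/-- `(#(Λ ∩ S))⁻¹ ∑_{λ ∈ Λ ∩ S} ⟨π(λ) g, h_λ⟩` with the canonical dual `(h_λ)`. The frame operator
being positive, the numbers `⟨π(λ) g, h_λ⟩` are real for a frame; the real part only changes the
type. -/
def frameAverage (π : ProjectiveRep G H) (Λ : Set G) (g : H) (S : Set G) : ℝ :=
  (∑ᶠ (l : Λ) (_ : (l : G) ∈ S),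
      (inner ℂ (canonicalDual (π.coherentSystem Λ g) l) (π l g)).re)
    / ((Λ ∩ S).ncard : ℝ)

/-- `M` is the lower frame measure of `π(Λ) g` along `K`. -/
def HasLowerFrameMeasure (π : ProjectiveRep G H) (Λ : Set G) (g : H) (K : ℕ → Set G)
    (M : ℝ) : Prop :=
  Tendsto (fun n => ⨅ x : G, π.frameAverage Λ g (x • K n)) atTop (𝓝 M)

/-- `M` is the upper frame measure of `π(Λ) g` along `K`. -/
def HasUpperFrameMeasure (π : ProjectiveRep G H) (Λ : Set G) (g : H) (K : ℕ → Set G)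
    (M : ℝ) : Prop :=
  Tendsto (fun n => ⨆ x : G, π.frameAverage Λ g (x • K n)) atTop (𝓝 M)

end ProjectiveRep

end CoherentFrame

end


/-! For a frame with dual `h`, `‖g‖² = ‖π(y) g‖² = ∑_λ ⟨π(y) g, h_λ⟩ ⟨π(λ) g, π(y) g⟩` for every
`y`, while by the orthogonality relations the integral of the `λ`-th summand over `y ∈ G` is
`d⁻¹ ‖g‖² ⟨π(λ) g, h_λ⟩`. Since `g ∈ 𝓑²_π`, the sum lives essentially on the `λ` near `y`,
uniformly in `y`. Integrating over `y ∈ x Kₙ`, the sum may therefore be restricted to `λ ∈ x Kₙ`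
and the integrals then extended to `G`, with errors supported near the boundary of `x Kₙ`, which
is negligible for a strong Følner sequence. Hence, uniformly in `x`,
`∑_{λ ∈ Λ ∩ x Kₙ} ⟨π(λ) g, h_λ⟩ = d μ(Kₙ) (1 + o(1))`, and dividing by `#(Λ ∩ x Kₙ)` turns suprema
of densities into infima of averages and conversely. -/

namespace CoherentFrame

section Boundary

variable {G : Type*} [Group G]

/-- The `C`-boundary of `P` inside `P`: the points of `P` of the form `q * c` with `q ∉ P` and
`c ∈ C`. -/
def innerBoundary (P C : Set G) : Set G := P ∩ (Pᶜ * C)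

theorem innerBoundary_subset (P C : Set G) : innerBoundary P C ⊆ P :=
  Set.inter_subset_left

theorem smul_innerBoundary (x : G) (P C : Set G) :
    x • innerBoundary P C = innerBoundary (x • P) C := by
  rw [innerBoundary, innerBoundary, Set.smul_set_inter, ← smul_mul_assoc, Set.smul_set_compl]

theorem innerBoundary_mul_subset (P C U : Set G) :
    innerBoundary P C * U ⊆ (P * (U ∪ C * U)) ∩ (Pᶜ * (U ∪ C * U)) := by
  rintro _ ⟨p, ⟨hp, q, hq, c, hc, rfl⟩, u, hu, rfl⟩
  exact ⟨⟨q * c, hp, u, Or.inl hu, rfl⟩,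
    ⟨q, hq, c * u, Or.inr ⟨c, hc, u, hu, rfl⟩, (mul_assoc _ _ _).symm⟩⟩

theorem smul_subset_of_notMem_innerBoundary {P C : Set G} {x : G} (hxP : x ∈ P)
    (hx : x ∉ innerBoundary P C⁻¹) : x • C ⊆ P := by
  rintro _ ⟨c, hc, rfl⟩
  by_contra hP
  exact hx ⟨hxP, x * c, hP, c⁻¹, Set.inv_mem_inv.2 hc, mul_inv_cancel_right x c⟩

theorem measurableSet_innerBoundary [TopologicalSpace G] [ContinuousMul G] [MeasurableSpace G]
    [OpensMeasurableSpace G] {P : Set G} (hP : IsClosed P) (C : Set G) :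
    MeasurableSet (innerBoundary P C) :=
  hP.measurableSet.inter hP.isOpen_compl.mul_right.measurableSet

theorem IsStrongFolner.tendsto_innerBoundary_mul [TopologicalSpace G] [ContinuousMul G]
    [MeasurableSpace G] {μ : Measure G} {K : ℕ → Set G} (hK : IsStrongFolner μ K) {C U : Set G}
    (hC : IsCompact C) (hU : IsCompact U) :
    Tendsto (fun n => μ (innerBoundary (K n) C * U) / μ (K n)) atTop (𝓝 0) :=
  tendsto_of_tendsto_of_tendsto_of_le_of_le tendsto_const_nhds
    (hK.tendsto_boundary _ (hU.union (hC.mul hU))) (fun _ => zero_le)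
    fun _ => ENNReal.div_le_div_right (measure_mono (innerBoundary_mul_subset _ _ _)) _

end Boundary

section BeurlingDensity

variable {G : Type*}

theorem encard_inter_mul_eq_tsum (Λ S : Set G) (c : ℝ≥0∞) :
    ((Λ ∩ S).encard : ℝ≥0∞) * c = ∑' l : Λ, S.indicator (fun _ => c) (l : G) := by
  rw [← Subtype.image_preimage_coe, Subtype.val_injective.encard_image]
  exact (ENNReal.tsum_set_const _ c).symm.trans
    (tsum_subtype (Subtype.val ⁻¹' S : Set Λ) fun _ => c)

variable [Group G] [TopologicalSpace G] [IsTopologicalGroup G] [MeasurableSpace G] [BorelSpace G]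

theorem isInvInvariant_of_isMulRightInvariant [LocallyCompactSpace G] (μ : Measure G)
    [μ.IsHaarMeasure] [μ.IsMulRightInvariant] [μ.Regular] : μ.IsInvInvariant := by
  have hscalar := Measure.isMulLeftInvariant_eq_smul_of_regular μ.inv μ
  obtain ⟨V, hVc, hV⟩ := exists_compact_mem_nhds (1 : G)
  have hS : μ (V ∩ V⁻¹) ≠ 0 :=
    (Measure.measure_pos_of_mem_nhds μ (inter_mem hV (inv_mem_nhds_one G hV))).ne'
  have hS' : μ (V ∩ V⁻¹) ≠ ∞ := measure_ne_top_of_subset Set.inter_subset_left hVc.measure_ne_top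
  have hone : ((Measure.haarScalarFactor μ.inv μ : ℝ≥0) : ℝ≥0∞) = 1 := by
    have h := congrArg (· (V ∩ V⁻¹)) hscalar
    simp only [Measure.inv_apply, Set.inter_inv, inv_inv, Set.inter_comm V⁻¹] at h
    exact (ENNReal.mul_eq_right hS hS').1 h.symm
  exact ⟨by rw [hscalar, ENNReal.coe_eq_one.1 hone, one_smul]⟩

theorem setLIntegral_encard_inter_smul (μ : Measure G) {Λ : Set G} (hΛ : Λ.Countable) {L : Set G}
    (hL : MeasurableSet L) (A : Set G) :
    ∫⁻ y in A, ((Λ ∩ y • L).encard : ℝ≥0∞) ∂μ = ∑' l : Λ, μ (A ∩ (l : G) • L⁻¹) := by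
  have := hΛ.to_subtype
  have hmeas (l : Λ) : MeasurableSet ((l : G) • L⁻¹) := hL.inv.const_smul _
  have hcount (y : G) : ((Λ ∩ y • L).encard : ℝ≥0∞)
      = ∑' l : Λ, ((l : G) • L⁻¹).indicator 1 y := by
    rw [← mul_one ((Λ ∩ y • L).encard : ℝ≥0∞), encard_inter_mul_eq_tsum]
    refine tsum_congr fun l => Set.indicator_eq_indicator ?_ rfl
    simp only [Set.mem_smul_set_iff_inv_smul_mem, smul_eq_mul, Set.mem_inv, mul_inv_rev, inv_inv]
  simp_rw [hcount]
  rw [lintegral_tsum fun l => (measurable_one.indicator (hmeas l)).aemeasurable]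
  refine tsum_congr fun l => ?_
  rw [lintegral_indicator_one (hmeas l), Measure.restrict_apply (hmeas l), Set.inter_comm]

section

variable [T2Space G] (μ : Measure G) [μ.IsMulLeftInvariant] [μ.IsInvInvariant] {Λ : Set G}

theorem encard_inter_mul_le (hΛ : Λ.Countable) (K : Set G) {L : Set G} (hL : IsCompact L) (x : G) :
    ((Λ ∩ x • K).encard : ℝ≥0∞) * μ L
      ≤ μ (K * L⁻¹) * ⨆ y : G, ((Λ ∩ y • L).encard : ℝ≥0∞) :=
  calc ((Λ ∩ x • K).encard : ℝ≥0∞) * μ L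
      = ∑' l : Λ, (x • K).indicator (fun _ => μ L) (l : G) := encard_inter_mul_eq_tsum ..
    _ ≤ ∑' l : Λ, μ (x • (K * L⁻¹) ∩ (l : G) • L⁻¹) := by
        refine ENNReal.tsum_le_tsum fun l =>
          Set.indicator_apply_le' (fun hl => ?_) (fun _ => zero_le)
        rw [Set.inter_eq_right.2, measure_smul, Measure.measure_inv]
        rw [← smul_mul_assoc]
        exact Set.smul_set_subset_mul hl
    _ = ∫⁻ y in x • (K * L⁻¹), ((Λ ∩ y • L).encard : ℝ≥0∞) ∂μ :=
        (setLIntegral_encard_inter_smul μ hΛ hL.measurableSet _).symm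
    _ ≤ ∫⁻ _ in x • (K * L⁻¹), (⨆ y : G, ((Λ ∩ y • L).encard : ℝ≥0∞)) ∂μ :=
        lintegral_mono fun y => le_iSup (fun y : G => ((Λ ∩ y • L).encard : ℝ≥0∞)) y
    _ = μ (K * L⁻¹) * ⨆ y : G, ((Λ ∩ y • L).encard : ℝ≥0∞) := by
        rw [setLIntegral_const, measure_smul, mul_comm]

theorem mul_iInf_encard_inter_le (hΛ : Λ.Countable) (K : Set G) {L : Set G} (hL : IsCompact L)
    (x : G) :
    μ (K \ innerBoundary K L⁻¹) * (⨅ y : G, ((Λ ∩ y • L).encard : ℝ≥0∞))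
      ≤ ((Λ ∩ x • K).encard : ℝ≥0∞) * μ L :=
  calc μ (K \ innerBoundary K L⁻¹) * (⨅ y : G, ((Λ ∩ y • L).encard : ℝ≥0∞))
      = ∫⁻ _ in x • (K \ innerBoundary K L⁻¹), (⨅ y : G, ((Λ ∩ y • L).encard : ℝ≥0∞)) ∂μ := by
        rw [setLIntegral_const, measure_smul, mul_comm]
    _ ≤ ∫⁻ y in x • (K \ innerBoundary K L⁻¹), ((Λ ∩ y • L).encard : ℝ≥0∞) ∂μ :=
        lintegral_mono fun y => iInf_le (fun y : G => ((Λ ∩ y • L).encard : ℝ≥0∞)) y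
    _ = ∑' l : Λ, μ (x • (K \ innerBoundary K L⁻¹) ∩ (l : G) • L⁻¹) :=
        setLIntegral_encard_inter_smul μ hΛ hL.measurableSet _
    _ ≤ ∑' l : Λ, (x • K).indicator (fun _ => μ L) (l : G) := by
        refine ENNReal.tsum_le_tsum fun l => ?_
        by_cases hl : (l : G) ∈ x • K
        · rw [Set.indicator_of_mem hl, ← Measure.measure_inv μ L, ← measure_smul μ (l : G) L⁻¹]
          exact measure_mono Set.inter_subset_right
        · suffices x • (K \ innerBoundary K L⁻¹) ∩ (l : G) • L⁻¹ = ∅ by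
            rw [this, measure_empty]
            exact zero_le
          rw [Set.smul_set_sdiff, smul_innerBoundary, Set.eq_empty_iff_forall_notMem]
          rintro _ ⟨⟨hyK, hy⟩, z, hz, rfl⟩
          exact hy ⟨hyK, (l : G), hl, z, hz, rfl⟩
    _ = ((Λ ∩ x • K).encard : ℝ≥0∞) * μ L := (encard_inter_mul_eq_tsum ..).symm

variable [IsFiniteMeasureOnCompacts μ]

theorem iSup_encard_inter_div_le (hΛ : Λ.Countable) {K L : Set G} (hK : IsCompact K)
    (hK0 : μ K ≠ 0) (hL : IsCompact L) (hL0 : μ L ≠ 0) :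
    ⨆ x : G, ((Λ ∩ x • K).encard : ℝ≥0∞) / μ K
      ≤ (1 + μ ((K * L⁻¹) ∆ K) / μ K) * ⨆ x : G, ((Λ ∩ x • L).encard : ℝ≥0∞) / μ L := by
  have hKt : μ K ≠ ∞ := hK.measure_ne_top
  have hLt : μ L ≠ ∞ := hL.measure_ne_top
  have hmeasure : μ (K * L⁻¹) ≤ (1 + μ ((K * L⁻¹) ∆ K) / μ K) * μ K := by
    rw [add_mul, one_mul, ENNReal.div_mul_cancel hK0 hKt]
    refine (measure_mono fun z hz => ?_).trans (measure_union_le _ _)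
    exact (em (z ∈ K)).imp_right fun h => Or.inl ⟨hz, h⟩
  refine iSup_le fun x => ?_
  rw [← ENNReal.iSup_div, ENNReal.div_le_iff hK0 hKt, mul_right_comm, ← mul_div_assoc,
    ENNReal.le_div_iff_mul_le (Or.inl hL0) (Or.inl hLt)]
  exact (encard_inter_mul_le μ hΛ K hL x).trans (by gcongr)

theorem le_iInf_encard_inter_div (hΛ : Λ.Countable) {K L : Set G} (hK : IsCompact K)
    (hK0 : μ K ≠ 0) (hL : IsCompact L) (hL0 : μ L ≠ 0) :
    (1 - μ (innerBoundary K L⁻¹) / μ K) * ⨅ x : G, ((Λ ∩ x • L).encard : ℝ≥0∞) / μ L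
      ≤ ⨅ x : G, ((Λ ∩ x • K).encard : ℝ≥0∞) / μ K := by
  have hKt : μ K ≠ ∞ := hK.measure_ne_top
  have hLt : μ L ≠ ∞ := hL.measure_ne_top
  have hmeasure : (1 - μ (innerBoundary K L⁻¹) / μ K) * μ K ≤ μ (K \ innerBoundary K L⁻¹) := by
    rw [ENNReal.sub_mul fun _ _ => hKt, one_mul, ENNReal.div_mul_cancel hK0 hKt]
    exact le_measure_sdiff
  have hinf : ⨅ x : G, ((Λ ∩ x • L).encard : ℝ≥0∞) / μ L
      ≤ (⨅ x : G, ((Λ ∩ x • L).encard : ℝ≥0∞)) / μ L := by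
    rw [ENNReal.le_div_iff_mul_le (Or.inl hL0) (Or.inl hLt)]
    refine le_iInf fun x => ?_
    rw [← ENNReal.le_div_iff_mul_le (Or.inl hL0) (Or.inl hLt)]
    exact iInf_le _ x
  refine le_iInf fun x => ?_
  rw [ENNReal.le_div_iff_mul_le (Or.inl hK0) (Or.inl hKt), mul_right_comm]
  refine (mul_le_mul' hmeasure hinf).trans ?_
  rw [← mul_div_assoc, ENNReal.div_le_iff hL0 hLt]
  exact mul_iInf_encard_inter_le μ hΛ K hL x

end

/-- The upper Beurling density of `Λ`, computed without a Følner sequence as an infimum over all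
compact non-null sets. -/
noncomputable def upperDensity (μ : Measure G) (Λ : Set G) : ℝ≥0∞ :=
  ⨅ (L : Set G) (_ : IsCompact L) (_ : μ L ≠ 0), ⨆ x : G, ((Λ ∩ x • L).encard : ℝ≥0∞) / μ L

/-- The lower Beurling density of `Λ`, computed without a Følner sequence as a supremum over all
compact non-null sets. -/
noncomputable def lowerDensity (μ : Measure G) (Λ : Set G) : ℝ≥0∞ :=
  ⨆ (L : Set G) (_ : IsCompact L) (_ : μ L ≠ 0), ⨅ x : G, ((Λ ∩ x • L).encard : ℝ≥0∞) / μ L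

variable [T2Space G] (μ : Measure G) [μ.IsMulLeftInvariant] [μ.IsInvInvariant]
  [IsFiniteMeasureOnCompacts μ] {Λ : Set G}

theorem hasUpperBeurlingDensity_upperDensity (hΛ : Λ.Countable) :
    HasUpperBeurlingDensity μ Λ (upperDensity μ Λ) := by
  refine fun K hK => tendsto_order.2 ⟨fun a ha => Eventually.of_forall fun n => ?_, fun b hb => ?_⟩
  · exact ha.trans_le (iInf₂_le_of_le (K n) (hK.isCompact n) (iInf_le _ (hK.measure_ne_zero n)))
  simp only [upperDensity, iInf_lt_iff] at hb
  obtain ⟨L, hL, hL0, hb⟩ := hb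
  have hlim : Tendsto (fun n => (1 + μ ((K n * L⁻¹) ∆ K n) / μ (K n)) *
      ⨆ x : G, ((Λ ∩ x • L).encard : ℝ≥0∞) / μ L) atTop
      (𝓝 ((1 + 0) * ⨆ x : G, ((Λ ∩ x • L).encard : ℝ≥0∞) / μ L)) :=
    ENNReal.Tendsto.mul_const ((hK.tendsto_symmDiff L⁻¹ hL.inv
      (nonempty_of_measure_ne_zero hL0).inv).const_add 1) (Or.inl (by simp))
  rw [add_zero, one_mul] at hlim
  filter_upwards [hlim.eventually_lt_const hb] with n hn
  exact (iSup_encard_inter_div_le μ hΛ (hK.isCompact n) (hK.measure_ne_zero n) hL hL0).trans_lt hn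

theorem hasLowerBeurlingDensity_lowerDensity (hΛ : Λ.Countable) :
    HasLowerBeurlingDensity μ Λ (lowerDensity μ Λ) := by
  refine fun K hK => tendsto_order.2 ⟨fun b hb => ?_, fun a ha => Eventually.of_forall fun n => ?_⟩
  swap
  · exact ha.trans_le' (le_iSup₂_of_le (K n) (hK.isCompact n)
      (le_iSup (fun _ : μ (K n) ≠ 0 => ⨅ x : G, ((Λ ∩ x • K n).encard : ℝ≥0∞) / μ (K n))
        (hK.measure_ne_zero n)))
  simp only [lowerDensity, lt_iSup_iff] at hb
  obtain ⟨L, hL, hL0, hb⟩ := hb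
  have hboundary : Tendsto (fun n => μ (innerBoundary (K n) L⁻¹) / μ (K n)) atTop (𝓝 0) := by
    simpa only [Set.singleton_one, mul_one] using
      hK.tendsto_innerBoundary_mul hL.inv (isCompact_singleton (x := (1 : G)))
  have hlim : Tendsto (fun n => (1 - μ (innerBoundary (K n) L⁻¹) / μ (K n)) *
      ⨅ x : G, ((Λ ∩ x • L).encard : ℝ≥0∞) / μ L) atTop
      (𝓝 ((1 - 0) * ⨅ x : G, ((Λ ∩ x • L).encard : ℝ≥0∞) / μ L)) :=
    ENNReal.Tendsto.mul_const (ENNReal.Tendsto.sub tendsto_const_nhds hboundary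
      (Or.inl (by simp))) (Or.inl (by simp))
  rw [tsub_zero, one_mul] at hlim
  filter_upwards [hlim.eventually_const_lt hb] with n hn
  exact hn.trans_le
    (le_iInf_encard_inter_div μ hΛ (hK.isCompact n) (hK.measure_ne_zero n) hL hL0)

end BeurlingDensity

section Frame

variable {ι H : Type*} [NormedAddCommGroup H] [InnerProductSpace ℂ H]

/-- The family `e` is a Bessel family whose analysis operator `f ↦ (⟨f, e i⟩)ᵢ` has norm at most
`b`. -/
def IsBesselWith (e : ι → H) (b : ℝ≥0) : Prop :=
  ∀ (f : H) (v : Finset ι), ∑ i ∈ v, ‖inner ℂ (e i) f‖ ^ 2 ≤ (b * ‖f‖) ^ 2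

/-- The family `h` is dual to `e`: the reconstruction formula `f = ∑ i, ⟨f, h i⟩ e i` holds. -/
def IsDualFamily (e h : ι → H) : Prop :=
  ∀ f : H, HasSum (fun i => inner ℂ (h i) f • e i) f

theorem IsDualFamily.hasSum_inner {e h : ι → H} (hd : IsDualFamily e h) (f f' : H) :
    HasSum (fun i => inner ℂ (h i) f * inner ℂ f' (e i)) (inner ℂ f' f) := by
  simpa only [innerSL_apply_apply, inner_smul_right] using (hd f).mapL (innerSL ℂ f')

theorem norm_sub_sum_mul_le_of_hasSum {a b : ι → ℂ} {s : ℂ} (hs : HasSum (fun i => a i * b i) s)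
    (t : Finset ι) {α β : ℝ} (hα : 0 ≤ α) (hβ : 0 ≤ β)
    (ha : ∀ v : Finset ι, ∑ i ∈ v, ‖a i‖ ^ 2 ≤ α ^ 2)
    (hb : ∀ v : Finset ι, Disjoint v t → ∑ i ∈ v, ‖b i‖ ^ 2 ≤ β ^ 2) :
    ‖s - ∑ i ∈ t, a i * b i‖ ≤ α * β := by
  classical
  refine le_of_tendsto (hs.sub_const (∑ i ∈ t, a i * b i)).norm ?_
  filter_upwards [eventually_ge_atTop t] with u hu
  rw [← Finset.sum_sdiff hu, add_sub_cancel_right]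
  refine (norm_sum_le _ _).trans (abs_le_of_sq_le_sq' ?_ (mul_nonneg hα hβ)).2
  calc (∑ i ∈ u \ t, ‖a i * b i‖) ^ 2
      ≤ (∑ i ∈ u \ t, ‖a i‖ ^ 2) * ∑ i ∈ u \ t, ‖b i‖ ^ 2 := by
        simpa only [norm_mul] using Finset.sum_mul_sq_le_sq_mul_sq _ _ _
    _ ≤ α ^ 2 * β ^ 2 := by
        gcongr
        · exact ha _
        · exact hb _ Finset.sdiff_disjoint
    _ = (α * β) ^ 2 := (mul_pow _ _ _).symm

namespace IsBesselWith

variable {e : ι → H} {b : ℝ≥0} (he : IsBesselWith e b)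

include he

theorem norm_le (i : ι) : ‖e i‖ ≤ b := by
  have h := he (e i) {i}
  rw [Finset.sum_singleton, inner_self_eq_norm_sq_to_K, norm_pow, RCLike.norm_ofReal,
    abs_of_nonneg (norm_nonneg _), sq_le_sq₀ (by positivity) (by positivity)] at h
  rcases (norm_nonneg (e i)).eq_or_lt with h0 | h0
  · exact h0 ▸ b.2
  · nlinarith

theorem memℓp (f : H) : Memℓp (fun i => inner ℂ (e i) f) 2 :=
  memℓp_gen (by simpa using summable_of_sum_le (fun i => by positivity) (he f))

/-- The analysis operator `f ↦ (⟨f, e i⟩)ᵢ` of a Bessel family. -/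
noncomputable def analysisOperator : H →L[ℂ] lp (fun _ : ι => ℂ) 2 :=
  LinearMap.mkContinuous
    { toFun f := ⟨fun i => inner ℂ (e i) f, he.memℓp f⟩
      map_add' f f' := by ext i; exact inner_add_right _ _ _
      map_smul' c f := by ext i; exact inner_smul_right _ _ _ } b fun f =>
    lp.norm_le_of_forall_sum_le (by simp) (by positivity) fun v => by simpa using he f v

theorem norm_analysisOperator_sq (f : H) :
    ‖he.analysisOperator f‖ ^ 2 = ∑' i, ‖inner ℂ (e i) f‖ ^ 2 := by
  have h := lp.norm_rpow_eq_tsum (p := 2) (by simp) (he.analysisOperator f)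
  simp only [ENNReal.toReal_ofNat, Real.rpow_ofNat] at h
  exact h

variable [CompleteSpace H]

theorem hasSum_adjoint_analysisOperator (f : H) :
    HasSum (fun i => inner ℂ (e i) f • e i)
      (he.analysisOperator.adjoint (he.analysisOperator f)) := by
  classical
  refine ((lp.hasSum_single (p := 2) (by simp) (he.analysisOperator f)).mapL
    he.analysisOperator.adjoint).congr_fun fun i => ext_inner_right ℂ fun f' => ?_
  rw [ContinuousLinearMap.adjoint_inner_left, lp.inner_single_left, inner_smul_left,
    RCLike.inner_apply, mul_comm]
  rfl

theorem adjoint_comp_analysisOperator :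
    ⇑(he.analysisOperator.adjoint ∘L he.analysisOperator) = frameOperator e :=
  funext fun f => (he.hasSum_adjoint_analysisOperator f).tsum_eq.symm

theorem hasSum_frameOperator (f : H) :
    HasSum (fun i => inner ℂ (e i) f • e i) (frameOperator e f) :=
  he.adjoint_comp_analysisOperator ▸ he.hasSum_adjoint_analysisOperator f

theorem inner_frameOperator_left (f f' : H) :
    inner ℂ (frameOperator e f) f' = inner ℂ f (frameOperator e f') := by
  simp only [← he.adjoint_comp_analysisOperator, ContinuousLinearMap.comp_apply,
    ContinuousLinearMap.adjoint_inner_left, ContinuousLinearMap.adjoint_inner_right]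

theorem norm_inner_frameOperator_self (f : H) :
    ‖inner ℂ (frameOperator e f) f‖ = ∑' i, ‖inner ℂ (e i) f‖ ^ 2 := by
  rw [← he.adjoint_comp_analysisOperator, ContinuousLinearMap.comp_apply,
    ContinuousLinearMap.adjoint_inner_left, inner_self_eq_norm_sq_to_K, norm_pow,
    RCLike.norm_ofReal, abs_norm, he.norm_analysisOperator_sq]

end IsBesselWith

namespace IsFrame

variable {e : ι → H} (he : IsFrame e)

include he

theorem exists_isBesselWith : ∃ b, IsBesselWith e b := by
  obtain ⟨A, B, -, hB, h⟩ := he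
  refine ⟨(√B).toNNReal, fun f v => ?_⟩
  rw [Real.coe_toNNReal _ B.sqrt_nonneg, mul_pow, Real.sq_sqrt hB.le]
  exact ((h f).1.sum_le_tsum v fun i _ => by positivity).trans (h f).2.2

theorem exists_ne_zero [Nontrivial H] : ∃ i, e i ≠ 0 := by
  obtain ⟨A, _, hA, -, h⟩ := he
  by_contra! h0
  obtain ⟨f, hf⟩ := exists_ne (0 : H)
  have hle := (h f).2.1
  simp only [h0, inner_zero_left, norm_zero, ne_eq, OfNat.ofNat_ne_zero, not_false_eq_true,
    zero_pow, tsum_zero] at hle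
  exact hle.not_gt (by positivity)

variable [CompleteSpace H]

theorem bijective_frameOperator : Function.Bijective (frameOperator e) := by
  obtain ⟨b, hb⟩ := he.exists_isBesselWith
  obtain ⟨A, _, hA, -, h⟩ := he
  rw [← hb.adjoint_comp_analysisOperator, ← ContinuousLinearMap.isUnit_iff_bijective]
  refine ContinuousLinearMap.isUnit_of_forall_le_norm_inner_map _ (c := ⟨A, hA.le⟩) hA fun f => ?_
  rw [hb.adjoint_comp_analysisOperator, hb.norm_inner_frameOperator_self, mul_comm]
  exact (h f).2.1

theorem inner_canonicalDual_frameOperator (i : ι) (f : H) :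
    inner ℂ (canonicalDual e i) (frameOperator e f) = inner ℂ (e i) f := by
  obtain ⟨b, hb⟩ := he.exists_isBesselWith
  rw [← hb.inner_frameOperator_left, canonicalDual,
    Function.invFun_eq (he.bijective_frameOperator.surjective (e i))]

theorem isDualFamily_canonicalDual : IsDualFamily e (canonicalDual e) := by
  obtain ⟨b, hb⟩ := he.exists_isBesselWith
  intro f
  obtain ⟨w, rfl⟩ := he.bijective_frameOperator.surjective f
  simpa only [he.inner_canonicalDual_frameOperator] using hb.hasSum_frameOperator w

theorem exists_isBesselWith_canonicalDual : ∃ b, IsBesselWith (canonicalDual e) b := by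
  obtain ⟨b, hb⟩ := he.exists_isBesselWith
  have hcoeff := he.inner_canonicalDual_frameOperator
  have hsurj := he.bijective_frameOperator.surjective
  obtain ⟨A, _, hA, -, h⟩ := he
  refine ⟨(√A⁻¹).toNNReal, fun f v => ?_⟩
  obtain ⟨w, rfl⟩ := hsurj f
  rw [Real.coe_toNNReal _ (Real.sqrt_nonneg _), mul_pow, Real.sq_sqrt (by positivity),
    inv_mul_eq_div, le_div_iff₀' hA]
  simp only [hcoeff]
  have hquad : ∑' i, ‖inner ℂ (e i) w‖ ^ 2 ≤ ‖frameOperator e w‖ * ‖w‖ :=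
    hb.norm_inner_frameOperator_self w ▸ norm_inner_le_norm _ _
  have hsum : ∑ i ∈ v, ‖inner ℂ (e i) w‖ ^ 2 ≤ ∑' i, ‖inner ℂ (e i) w‖ ^ 2 :=
    (h w).1.sum_le_tsum v fun i _ => by positivity
  have hnorm : A * ‖w‖ ≤ ‖frameOperator e w‖ := by
    rcases (norm_nonneg w).eq_or_lt with h0 | h0
    · simp [← h0]
    · exact le_of_mul_le_mul_right (by linarith [(h w).2.1, pow_two ‖w‖]) h0
  nlinarith [norm_nonneg w, norm_nonneg (frameOperator e w)]

end IsFrame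

end Frame

theorem exists_measure_norm_sub_lt_ne_zero {X E : Type*} [MeasurableSpace X]
    [NormedAddCommGroup E] {F : X → E} (hF : StronglyMeasurable F) (μ : Measure X) [NeZero μ]
    {ε : ℝ} (hε : 0 < ε) : ∃ v, μ {x | ‖F x - v‖ < ε} ≠ 0 := by
  obtain ⟨D, hDc, hD⟩ := hF.isSeparable_range
  have hcover : ⋃ v ∈ D, {x | ‖F x - v‖ < ε} = Set.univ := by
    refine Set.eq_univ_of_forall fun x => ?_
    obtain ⟨v, hv, hd⟩ := Metric.mem_closure_iff.1 (hD ⟨x, rfl⟩) ε hε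
    exact Set.mem_biUnion hv (by rwa [dist_eq_norm] at hd)
  by_contra! h
  have hnull := (measure_biUnion_null_iff hDc).2 fun v _ => h v
  rw [hcover] at hnull
  exact NeZero.ne (μ Set.univ) hnull

namespace ProjectiveRep

section Basic

variable {G H : Type*} [Group G] [MeasurableSpace G]
  [NormedAddCommGroup H] [InnerProductSpace ℂ H] (π : ProjectiveRep G H)

theorem exists_map_mul (x y : G) : ∃ c : Circle, ∀ f, π (x * y) f = (c : ℂ) • π x (π y f) :=
  π.exists_cocycle.imp' (· (x, y)) fun _ h => h x y

theorem exists_map_one : ∃ c : Circle, ∀ f, π 1 f = (c : ℂ) • f := by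
  obtain ⟨c, hc⟩ := π.exists_map_mul 1 1
  refine ⟨c⁻¹, fun f => ?_⟩
  rw [Circle.coe_inv, eq_inv_smul_iff₀ c.coe_ne_zero]
  refine (π 1).injective ?_
  rw [map_smul, ← hc, mul_one]

theorem exists_map_eq_smul_map_inv_mul (x y : G) :
    ∃ c : Circle, ∀ f, π y f = (c : ℂ) • π x (π (x⁻¹ * y) f) := by
  simpa only [mul_inv_cancel_left] using π.exists_map_mul x (x⁻¹ * y)

theorem norm_inner_map_map (x y : G) (f g : H) :
    ‖inner ℂ (π x g) (π y f)‖ = ‖inner ℂ (π (y⁻¹ * x) g) f‖ := by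
  obtain ⟨c, hc⟩ := π.exists_map_eq_smul_map_inv_mul y x
  rw [hc, inner_smul_left, LinearIsometryEquiv.inner_map_map, norm_mul, RCLike.norm_conj,
    Circle.norm_coe, one_mul]

theorem norm_inner_map_inv (x : G) (f g : H) :
    ‖inner ℂ (π x⁻¹ g) f‖ = ‖inner ℂ (π x f) g‖ := by
  obtain ⟨c, hc⟩ := π.exists_map_one
  rw [← mul_one x⁻¹, ← norm_inner_map_map, hc, inner_smul_left, norm_mul, RCLike.norm_conj,
    Circle.norm_coe, one_mul, norm_inner_symm]

theorem exists_norm_map_inv_mul_sub_smul (x y : G) (u : H) :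
    ∃ c : Circle, ‖π (x⁻¹ * y) u - (c : ℂ) • u‖ = ‖π y u - π x u‖ := by
  obtain ⟨c, hc⟩ := π.exists_map_eq_smul_map_inv_mul x y
  refine ⟨c⁻¹, ?_⟩
  have h : π y u - π x u = (c : ℂ) • π x (π (x⁻¹ * y) u - ((c⁻¹ : Circle) : ℂ) • u) := by
    rw [map_sub, smul_sub, ← hc, map_smul, smul_smul, Circle.coe_inv,
      mul_inv_cancel₀ c.coe_ne_zero, one_smul]
  rw [h, norm_smul, Circle.norm_coe, one_mul, LinearIsometryEquiv.norm_map]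

theorem abs_norm_inner_sub_norm_inner_le (x y : G) (c : Circle) (f u : H) :
    |‖inner ℂ (π y u) f‖ - ‖inner ℂ (π x u) f‖| ≤ ‖π (x⁻¹ * y) u - (c : ℂ) • u‖ * ‖f‖ := by
  obtain ⟨c', hc'⟩ := π.exists_map_eq_smul_map_inv_mul x y
  have hx : ‖inner ℂ (π x u) f‖ = ‖inner ℂ ((c' : ℂ) • π x ((c : ℂ) • u)) f‖ := by
    simp only [map_smul, inner_smul_left, norm_mul, RCLike.norm_conj, Circle.norm_coe, one_mul]
  calc |‖inner ℂ (π y u) f‖ - ‖inner ℂ (π x u) f‖|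
      ≤ ‖inner ℂ ((c' : ℂ) • π x (π (x⁻¹ * y) u - (c : ℂ) • u)) f‖ := by
        rw [hx, hc', map_sub, smul_sub, inner_sub_left]
        exact abs_norm_sub_norm_le _ _
    _ ≤ ‖(c' : ℂ) • π x (π (x⁻¹ * y) u - (c : ℂ) • u)‖ * ‖f‖ := norm_inner_le_norm _ _
    _ = ‖π (x⁻¹ * y) u - (c : ℂ) • u‖ * ‖f‖ := by
        rw [norm_smul, Circle.norm_coe, one_mul, LinearIsometryEquiv.norm_map]

theorem stronglyMeasurable_coeff (g f : H) : StronglyMeasurable (π.coeff g f) :=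
  (π.stronglyMeasurable g).inner stronglyMeasurable_const

end Basic

section Continuity

variable {G : Type*} [Group G] [TopologicalSpace G] [IsTopologicalGroup G]
    [LocallyCompactSpace G] [SecondCountableTopology G] [MeasurableSpace G] [BorelSpace G]
    {H : Type*} [NormedAddCommGroup H] [InnerProductSpace ℂ H] (π : ProjectiveRep G H)

/-- The Steinhaus argument: `A⁻¹ * A` is a neighbourhood of `1` for every non-null set `A` on which
`x ↦ π x u` varies by less than `ε`. -/
theorem eventually_exists_norm_map_sub_smul_lt (u : H) {ε : ℝ} (hε : 0 < ε) :
    ∀ᶠ z in 𝓝 (1 : G), ∃ c : Circle, ‖π z u - (c : ℂ) • u‖ < ε := by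
  borelize H
  obtain ⟨v, hv⟩ := exists_measure_norm_sub_lt_ne_zero (π.stronglyMeasurable u)
    (Measure.haar : Measure G) (half_pos hε)
  have hmeas : MeasurableSet {x | ‖π x u - v‖ < ε / 2} :=
    measurableSet_lt ((π.stronglyMeasurable u).sub stronglyMeasurable_const).norm.measurable
      measurable_const
  have hnhds := Measure.div_mem_nhds_one_of_haar_pos Measure.haar _ hmeas.inv
    (pos_iff_ne_zero.2 (mt (measure_inv_null _).1 hv))
  filter_upwards [hnhds] with z hz
  obtain ⟨x, hx, y, hy, rfl⟩ := Set.mem_div.1 hz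
  obtain ⟨c, hc⟩ := π.exists_norm_map_inv_mul_sub_smul x⁻¹ y⁻¹ u
  rw [inv_inv, ← div_eq_mul_inv] at hc
  refine ⟨c, hc.trans_lt ?_⟩
  calc ‖π y⁻¹ u - π x⁻¹ u‖ = ‖(π y⁻¹ u - v) - (π x⁻¹ u - v)‖ := by congr 1; abel
    _ ≤ ‖π y⁻¹ u - v‖ + ‖π x⁻¹ u - v‖ := norm_sub_le _ _
    _ < ε / 2 + ε / 2 := add_lt_add hy hx
    _ = ε := add_halves ε

theorem continuous_norm_coeff (g f : H) : Continuous fun x => ‖π.coeff g f x‖ := by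
  refine continuous_iff_continuousAt.2 fun x₀ => Metric.tendsto_nhds.2 fun ε hε => ?_
  have htranslate : Tendsto (fun x => x₀⁻¹ * x) (𝓝 x₀) (𝓝 1) := by
    simpa only [inv_mul_cancel] using (continuous_const_mul x₀⁻¹).tendsto x₀
  filter_upwards [htranslate.eventually (π.eventually_exists_norm_map_sub_smul_lt g
    (ε := ε / (‖f‖ + 1)) (by positivity))] with x ⟨c, hc⟩
  calc |‖π.coeff g f x‖ - ‖π.coeff g f x₀‖|
      ≤ ‖π (x₀⁻¹ * x) g - (c : ℂ) • g‖ * ‖f‖ := π.abs_norm_inner_sub_norm_inner_le x₀ x c f g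
    _ ≤ ε / (‖f‖ + 1) * ‖f‖ := by gcongr
    _ < ε := by
        rw [div_mul_eq_mul_div, div_lt_iff₀ (by positivity)]
        nlinarith [norm_nonneg f]

end Continuity

section Schur

variable {G H : Type*} [Group G] [MeasurableSpace G]
  [NormedAddCommGroup H] [InnerProductSpace ℂ H] {π : ProjectiveRep G H}

theorem IsIrreducible.eq_zero_or_injective (hπ : π.IsIrreducible) {F : Type*}
    [NormedAddCommGroup F] [NormedSpace ℂ F] {T : H →L[ℂ] F}
    (hT : ∀ x f, T f = 0 → T (π x f) = 0) : T = 0 ∨ Function.Injective T := by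
  rcases hπ (LinearMap.ker T.toLinearMap) T.isClosed_ker hT with h | h
  · exact Or.inr (LinearMap.ker_eq_bot.1 h)
  · exact Or.inl (ContinuousLinearMap.coe_injective (LinearMap.ker_eq_top.1 h))

variable [CompleteSpace H]

theorem cfc_map_of_intertwining (φ : ℝ → ℝ) {T : H →L[ℂ] H}
    (hcomm : ∀ x f, T (π x f) = π x (T f)) (x : G) (f : H) :
    cfc φ T (π x f) = π x (cfc φ T f) := by
  have h : Commute T ((π x).toContinuousLinearEquiv : H →L[ℂ] H) :=
    ContinuousLinearMap.ext (hcomm x)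
  exact congrArg (fun S : H →L[ℂ] H => S f) (h.cfc_real φ).eq

/-- If `r < s` were in the spectrum, with midpoint `c`, the operators `(T - c)⁺` and `(T - c)⁻`
would be non-zero intertwiners with product `0`. -/
theorem IsIrreducible.spectrum_subsingleton (hπ : π.IsIrreducible) {T : H →L[ℂ] H}
    (hT : IsSelfAdjoint T) (hcomm : ∀ x f, T (π x f) = π x (T f)) :
    (spectrum ℝ T).Subsingleton := by
  by_contra hsp
  obtain ⟨r, hr, s, hs, hrs⟩ := (Set.not_subsingleton_iff.1 hsp).exists_lt
  let c : ℝ := (r + s) / 2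
  let p : ℝ → ℝ := fun t => max 0 (t - c)
  let q : ℝ → ℝ := fun t => max 0 (c - t)
  have hp : Continuous p := by fun_prop
  have hq : Continuous q := by fun_prop
  have hpT : cfc p T ≠ 0 := fun h => by
    have := (cfc_eq_cfc_iff_eqOn (f := p) (g := 0)).1 (h.trans (cfc_zero ℝ T).symm) hs
    simp only [p, c, Pi.zero_apply, max_eq_left_iff] at this
    linarith
  have hqT : cfc q T ≠ 0 := fun h => by
    have := (cfc_eq_cfc_iff_eqOn (f := q) (g := 0)).1 (h.trans (cfc_zero ℝ T).symm) hr
    simp only [q, c, Pi.zero_apply, max_eq_left_iff] at this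
    linarith
  have hpq : cfc p T * cfc q T = 0 := by
    rw [← cfc_mul p q T hp.continuousOn hq.continuousOn, ← cfc_zero ℝ T]
    congr 1
    funext t
    rcases le_total t c with h | h
    · simp [p, h]
    · simp [q, h]
  rcases hπ.eq_zero_or_injective (T := cfc p T) fun x f hf => by
      rw [cfc_map_of_intertwining p hcomm, hf, map_zero] with h | h
  · exact hpT h
  · refine hqT (ContinuousLinearMap.ext fun f => h ?_)
    rw [zero_apply, map_zero, ← mul_apply_eq_comp, hpq, zero_apply]

theorem IsIrreducible.exists_eq_smul [Nontrivial H] (hπ : π.IsIrreducible) {T : H →L[ℂ] H}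
    (hT : IsSelfAdjoint T) (hcomm : ∀ x f, T (π x f) = π x (T f)) :
    ∃ r : ℝ, ∀ f, T f = (r : ℂ) • f := by
  obtain ⟨r, hr⟩ := ContinuousFunctionalCalculus.spectrum_nonempty (R := ℝ) T hT
  have h := CFC.eq_algebraMap_of_spectrum_subset_singleton T r
    (fun s hs => hπ.spectrum_subsingleton hT hcomm hs hr) hT
  exact ⟨r, fun f => congrArg (fun S : H →L[ℂ] H => S f) h⟩

end Schur

end ProjectiveRep

theorem sesquilinear_ext_diag {E : Type*} [AddCommGroup E] [Module ℂ E]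
    {B B' : E →ₗ⋆[ℂ] E →ₗ[ℂ] ℂ} (h : ∀ a, B a a = B' a a) : B = B' := by
  refine LinearMap.ext₂ fun a b => ?_
  have h1 := h (a + b)
  have h2 := h (a + Complex.I • b)
  simp only [map_add, LinearMap.add_apply, h, map_smulₛₗ, LinearMap.smul_apply, RingHom.id_apply,
    smul_eq_mul, Complex.conj_I] at h1 h2
  linear_combination h1 / 2 - Complex.I / 2 * h2 + (B a b - B' a b - B b a + B' b a) / 2 *
    Complex.I_sq

theorem inner_mul_inner_swap {E : Type*} [NormedAddCommGroup E] [InnerProductSpace ℂ E]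
    (a b : E) : inner ℂ a b * inner ℂ b a = ((‖inner ℂ a b‖ ^ 2 : ℝ) : ℂ) := by
  rw [← inner_conj_symm b, Complex.mul_conj', Complex.ofReal_pow]

namespace ProjectiveRep

section Intertwiner

variable {G H E : Type*} [Group G] [MeasurableSpace G]
  [NormedAddCommGroup H] [InnerProductSpace ℂ H] [CompleteSpace H]
  [NormedAddCommGroup E] [InnerProductSpace ℂ E] [CompleteSpace E] {π : ProjectiveRep G H}

theorem IsIrreducible.exists_apply_adjoint_eq_smul [Nontrivial H] (hπ : π.IsIrreducible)
    (J : E →L[ℂ] H) {U : G → E → E} (hsurj : ∀ x, Function.Surjective (U x))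
    (hJ : ∀ x w, J (U x w) = π x (J w))
    (hinner : ∀ x w v, inner ℂ (U x w) (U x v) = inner ℂ w v) :
    ∃ r : ℝ, ∀ f, J (J.adjoint f) = (r : ℂ) • f := by
  refine hπ.exists_eq_smul J.isPositive_self_comp_adjoint.isSelfAdjoint fun x f => ?_
  have hadj : J.adjoint (π x f) = U x (J.adjoint f) := by
    refine ext_inner_right ℂ fun v => ?_
    obtain ⟨v, rfl⟩ := hsurj x v
    rw [ContinuousLinearMap.adjoint_inner_left, hJ, LinearIsometryEquiv.inner_map_map, hinner,
      ContinuousLinearMap.adjoint_inner_left]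
  rw [ContinuousLinearMap.comp_apply, ContinuousLinearMap.comp_apply, hadj, hJ]

theorem IsIrreducible.exists_norm_sq_eq (hπ : π.IsIrreducible) {J : E →L[ℂ] H}
    (hinj : Function.Injective J) (hJ0 : J ≠ 0) {U : G → E → E}
    (hsurj : ∀ x, Function.Surjective (U x)) (hJ : ∀ x w, J (U x w) = π x (J w))
    (hinner : ∀ x w v, inner ℂ (U x w) (U x v) = inner ℂ w v) :
    ∃ r : ℝ, r ≠ 0 ∧ ∀ f, ∃ w, J w = f ∧ ‖f‖ ^ 2 = r * ‖w‖ ^ 2 := by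
  obtain ⟨w₀, hw₀⟩ := DFunLike.ne_iff.1 hJ0
  have : Nontrivial H := nontrivial_of_ne _ _ hw₀
  obtain ⟨r, hr⟩ := hπ.exists_apply_adjoint_eq_smul J hsurj hJ hinner
  have hadj (w : E) : J.adjoint (J w) = (r : ℂ) • w := hinj (by rw [hr, map_smul])
  have hnorm (w : E) : ‖J w‖ ^ 2 = r * ‖w‖ ^ 2 := by
    rw [ContinuousLinearMap.apply_norm_sq_eq_inner_adjoint_left, ContinuousLinearMap.comp_apply,
      hadj, inner_smul_left, Complex.conj_ofReal, ← inner_self_eq_norm_sq (𝕜 := ℂ)]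
    exact Complex.re_ofReal_mul _ _
  have hr0 : r ≠ 0 := fun h => hw₀ (by simpa [h] using hnorm w₀)
  refine ⟨r, hr0, fun f => ?_⟩
  have hf : J ((r : ℂ)⁻¹ • J.adjoint f) = f := by
    rw [map_smul, hr, inv_smul_smul₀ (Complex.ofReal_ne_zero.2 hr0)]
  exact ⟨_, hf, by rw [← hnorm, hf]⟩

end Intertwiner

section CoeffGraph

variable {G H : Type*} [Group G] [MeasurableSpace G]
  [NormedAddCommGroup H] [InnerProductSpace ℂ H] (π : ProjectiveRep G H) (μ : Measure G)

/-- The graph of the coefficient transform `f ↦ V_u f`, a possibly only partially defined operator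
from `H` to `L²(μ)`. -/
noncomputable def coeffGraph (u : H) : Submodule ℂ (WithLp 2 (H × Lp ℂ 2 μ)) where
  carrier := {p | p.snd =ᵐ[μ] π.coeff u p.fst}
  zero_mem' := by
    filter_upwards [Lp.coeFn_zero ℂ 2 μ] with x hx
    simpa [coeff] using hx
  add_mem' := by
    intro p q hp hq
    filter_upwards [hp, hq, Lp.coeFn_add p.snd q.snd] with x hpx hqx hadd
    rw [WithLp.add_snd, WithLp.add_fst, hadd, Pi.add_apply, hpx, hqx]
    exact (inner_add_right _ _ _).symm
  smul_mem' := by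
    intro c p hp
    filter_upwards [hp, Lp.coeFn_smul c p.snd] with x hpx hsmul
    rw [WithLp.smul_snd, WithLp.smul_fst, hsmul, Pi.smul_apply, hpx]
    exact (inner_smul_right _ _ _).symm

theorem isClosed_coeffGraph (u : H) :
    IsClosed (π.coeffGraph μ u : Set (WithLp 2 (H × Lp ℂ 2 μ))) := by
  refine IsSeqClosed.isClosed fun p q hp hpq => ?_
  have hfst : Tendsto (fun n => (p n).fst) atTop (𝓝 q.fst) :=
    ((WithLp.fstL 2 ℂ H (Lp ℂ 2 μ)).continuous.tendsto q).comp hpq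
  have hsnd : Tendsto (fun n => (p n).snd) atTop (𝓝 q.snd) :=
    ((WithLp.sndL 2 ℂ H (Lp ℂ 2 μ)).continuous.tendsto q).comp hpq
  obtain ⟨ns, hns, hae⟩ := (tendstoInMeasure_of_tendsto_Lp hsnd).exists_seq_tendsto_ae
  have hgraph : ∀ᵐ x ∂μ, ∀ n, (p n).snd x = π.coeff u (p n).fst x := ae_all_iff.2 hp
  change _ =ᵐ[μ] _
  filter_upwards [hae, hgraph] with x hx hpx
  simp only [hpx] at hx
  exact tendsto_nhds_unique hx (tendsto_const_nhds.inner (hfst.comp hns.tendsto_atTop))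

variable {π μ} {u : H}

theorem exists_mem_coeffGraph {f : H} (hf : MemLp (π.coeff u f) 2 μ) :
    ∃ w : π.coeffGraph μ u, w.1.fst = f :=
  ⟨⟨WithLp.toLp 2 (f, hf.toLp _), hf.coeFn_toLp⟩, rfl⟩

theorem memLp_of_mem_coeffGraph (w : π.coeffGraph μ u) : MemLp (π.coeff u w.1.fst) 2 μ :=
  (memLp_congr_ae w.2).1 (Lp.memLp _)

theorem inner_coeffGraph (w v : π.coeffGraph μ u) :
    inner ℂ w v = inner ℂ w.1.fst v.1.fst +
      ∫ x, inner ℂ (π.coeff u w.1.fst x) (π.coeff u v.1.fst x) ∂μ := by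
  rw [Submodule.coe_inner, WithLp.prod_inner_apply, L2.inner_def]
  congr 1
  refine integral_congr_ae ?_
  filter_upwards [w.2, v.2] with x hw hv
  exact congrArg₂ (inner ℂ) hw hv

theorem norm_sq_coeffGraph (w : π.coeffGraph μ u) :
    ‖w‖ ^ 2 = ‖w.1.fst‖ ^ 2 + ∫ x, ‖π.coeff u w.1.fst x‖ ^ 2 ∂μ := by
  apply Complex.ofReal_injective
  rw [Complex.ofReal_add, ← integral_complex_ofReal]
  have h := (inner_self_eq_norm_sq_to_K (𝕜 := ℂ) w).symm.trans (inner_coeffGraph w w)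
  simpa only [inner_self_eq_norm_sq_to_K, Complex.coe_algebraMap, Complex.ofReal_pow] using h

theorem injective_fst_coeffGraph :
    Function.Injective fun w : π.coeffGraph μ u => w.1.fst := by
  refine fun w v h => Subtype.ext (WithLp.ofLp_injective 2 (Prod.ext h (Lp.ext ?_)))
  have hw : w.1.snd =ᵐ[μ] π.coeff u v.1.fst := (congrArg (π.coeff u) h) ▸ w.2
  have hv : v.1.snd =ᵐ[μ] π.coeff u v.1.fst := v.2
  exact hw.trans hv.symm

end CoeffGraph

section Translation

variable {G H : Type*} [Group G] [MeasurableSpace G]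
  [NormedAddCommGroup H] [InnerProductSpace ℂ H] {π : ProjectiveRep G H} {μ : Measure G}
  {u f : H}

theorem memLp_coeff_swap [MeasurableInv G] [μ.IsInvInvariant] (hf : MemLp (π.coeff u f) 2 μ) :
    MemLp (π.coeff f u) 2 μ :=
  (hf.comp_measurePreserving (Measure.measurePreserving_inv μ)).congr_norm
    (π.stronglyMeasurable_coeff f u).aestronglyMeasurable
    (Eventually.of_forall fun x => π.norm_inner_map_inv x f u)

theorem integral_norm_coeff_sq_swap [MeasurableInv G] [μ.IsInvInvariant] (u f : H) :
    ∫ x, ‖π.coeff u f x‖ ^ 2 ∂μ = ∫ x, ‖π.coeff f u x‖ ^ 2 ∂μ := by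
  rw [← integral_inv_eq_self]
  simp only [coeff, norm_inner_map_inv]

variable [MeasurableMul G] [μ.IsMulLeftInvariant]

theorem memLp_coeff_map (hf : MemLp (π.coeff u f) 2 μ) (x : G) :
    MemLp (π.coeff u (π x f)) 2 μ :=
  (hf.comp_measurePreserving (measurePreserving_mul_left μ x⁻¹)).congr_norm
    (π.stronglyMeasurable_coeff u (π x f)).aestronglyMeasurable
    (Eventually.of_forall fun y => (π.norm_inner_map_map y x f u).symm)

theorem memLp_coeff_map_symm (hf : MemLp (π.coeff u f) 2 μ) (x : G) :
    MemLp (π.coeff u ((π x).symm f)) 2 μ := by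
  refine (hf.comp_measurePreserving (measurePreserving_mul_left μ x)).congr_norm
    (π.stronglyMeasurable_coeff u _).aestronglyMeasurable (Eventually.of_forall fun y => ?_)
  have h := π.norm_inner_map_map (x * y) x ((π x).symm f) u
  rwa [LinearIsometryEquiv.apply_symm_apply, inv_mul_cancel_left] at h

theorem integral_inner_coeff_map (u f f' : H) (x : G) :
    ∫ y, inner ℂ (π.coeff u (π x f) y) (π.coeff u (π x f') y) ∂μ
      = ∫ y, inner ℂ (π.coeff u f y) (π.coeff u f' y) ∂μ := by
  rw [← integral_mul_left_eq_self (fun y => inner ℂ (π.coeff u f y) (π.coeff u f' y)) x⁻¹]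
  congr 1
  funext y
  obtain ⟨c, hc⟩ := π.exists_map_eq_smul_map_inv_mul x y
  have hcoeff (v : H) : π.coeff u (π x v) y = conj (c : ℂ) • π.coeff u v (x⁻¹ * y) := by
    rw [coeff, hc, inner_smul_left, LinearIsometryEquiv.inner_map_map, coeff, smul_eq_mul]
  rw [hcoeff, hcoeff, inner_smul_left, inner_smul_right, ← mul_assoc, RCLike.conj_conj,
    ← Circle.coe_inv_eq_conj, ← Circle.coe_mul, mul_inv_cancel, Circle.coe_one, one_mul]

theorem IsIrreducible.exists_integral_norm_coeff_sq [CompleteSpace H] (hπ : π.IsIrreducible)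
    (hf : f ≠ 0) (hmem : MemLp (π.coeff u f) 2 μ) :
    ∃ C : ℝ, ∀ f', MemLp (π.coeff u f') 2 μ ∧ ∫ x, ‖π.coeff u f' x‖ ^ 2 ∂μ = C * ‖f'‖ ^ 2 := by
  have : CompleteSpace (π.coeffGraph μ u) := (π.isClosed_coeffGraph μ u).completeSpace_coe
  let J : π.coeffGraph μ u →L[ℂ] H :=
    (WithLp.fstL 2 ℂ H (Lp ℂ 2 μ)).comp (π.coeffGraph μ u).subtypeL
  have hJ (w : π.coeffGraph μ u) : J w = w.1.fst := rfl
  have hinj : Function.Injective J := injective_fst_coeffGraph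
  have hJ0 : J ≠ 0 := fun h => by
    obtain ⟨w, hw⟩ := exists_mem_coeffGraph hmem
    exact hf (by rw [← hw, ← hJ, h, zero_apply])
  choose U hU using fun (x : G) (w : π.coeffGraph μ u) =>
    exists_mem_coeffGraph (memLp_coeff_map (memLp_of_mem_coeffGraph w) x)
  have hsurj (x : G) : Function.Surjective (U x) := fun v => by
    obtain ⟨w, hw⟩ := exists_mem_coeffGraph (memLp_coeff_map_symm (memLp_of_mem_coeffGraph v) x)
    exact ⟨w, hinj (by rw [hJ, hU, hw, LinearIsometryEquiv.apply_symm_apply, hJ])⟩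
  have hinner (x : G) (w v : π.coeffGraph μ u) : inner ℂ (U x w) (U x v) = inner ℂ w v := by
    rw [inner_coeffGraph, hU, hU, integral_inner_coeff_map, LinearIsometryEquiv.inner_map_map,
      ← inner_coeffGraph]
  obtain ⟨r, hr0, hr⟩ := hπ.exists_norm_sq_eq hinj hJ0 hsurj hU hinner
  refine ⟨r⁻¹ - 1, fun f' => ?_⟩
  obtain ⟨w, rfl, hw⟩ := hr f'
  refine ⟨memLp_of_mem_coeffGraph w, ?_⟩
  have hnorm : r⁻¹ * ‖J w‖ ^ 2 = ‖w‖ ^ 2 := by rw [hw, inv_mul_cancel_left₀ hr0]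
  rw [sub_mul, one_mul, hnorm, norm_sq_coeffGraph, hJ, add_sub_cancel_left]

end Translation

section FormalDegree

variable {G H : Type*} [Group G] [MeasurableSpace G]
  [NormedAddCommGroup H] [InnerProductSpace ℂ H] {π : ProjectiveRep G H} {μ : Measure G}

theorem integrable_inner_mul_inner {f₁ f₂ g₁ g₂ : H} (h₁ : MemLp (π.coeff g₁ f₁) 2 μ)
    (h₂ : MemLp (π.coeff g₂ f₂) 2 μ) :
    Integrable (fun x => inner ℂ (π x g₁) f₁ * inner ℂ f₂ (π x g₂)) μ := by
  refine h₁.integrable_mul (h₂.congr_norm (g := fun x => inner ℂ f₂ (π x g₂)) ?_ ?_)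
  · exact (stronglyMeasurable_const.inner (π.stronglyMeasurable g₂)).aestronglyMeasurable
  · exact Eventually.of_forall fun x => norm_inner_symm _ _

theorem integral_inner_mul_inner_of_norm_sq {g : H} {c : ℝ} (hmem : ∀ f, MemLp (π.coeff g f) 2 μ)
    (hnorm : ∀ f, ∫ x, ‖π.coeff g f x‖ ^ 2 ∂μ = c * ‖f‖ ^ 2) (f₁ f₂ : H) :
    ∫ x, inner ℂ (π x g) f₁ * inner ℂ f₂ (π x g) ∂μ = c * inner ℂ f₂ f₁ := by
  have hint (f₁ f₂ : H) := integrable_inner_mul_inner (hmem f₁) (hmem f₂)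
  let B : H →ₗ⋆[ℂ] H →ₗ[ℂ] ℂ := LinearMap.mk₂'ₛₗ (starRingEnd ℂ) (RingHom.id ℂ)
    (fun f₂ f₁ => ∫ x, inner ℂ (π x g) f₁ * inner ℂ f₂ (π x g) ∂μ)
    (fun a b f₁ => by
      simp only [inner_add_left, mul_add, integral_add (hint f₁ a) (hint f₁ b)])
    (fun k a f₁ => by
      simp only [inner_smul_left, mul_left_comm _ (conj k), integral_const_mul, smul_eq_mul])
    (fun f₂ a b => by
      simp only [inner_add_right, add_mul, integral_add (hint a f₂) (hint b f₂)])
    (fun k f₂ a => by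
      simp only [inner_smul_right, mul_assoc, integral_const_mul, smul_eq_mul, RingHom.id_apply])
  have hB : B = (c : ℂ) • innerₛₗ ℂ := sesquilinear_ext_diag fun f => by
    change ∫ x, inner ℂ (π x g) f * inner ℂ f (π x g) ∂μ = c * inner ℂ f f
    have hnormf : ∫ x, ‖inner ℂ (π x g) f‖ ^ 2 ∂μ = c * ‖f‖ ^ 2 := hnorm f
    simp only [inner_mul_inner_swap]
    rw [integral_complex_ofReal, hnormf, inner_self_eq_norm_sq_to_K]
    push_cast
    rfl
  exact congrArg (fun B : H →ₗ⋆[ℂ] H →ₗ[ℂ] ℂ => B f₂ f₁) hB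

theorem isFormalDegree_of_integral_norm_coeff_sq {d : ℝ} (hd : 0 < d)
    (hmem : ∀ g f, MemLp (π.coeff g f) 2 μ)
    (hnorm : ∀ g f, ∫ x, ‖π.coeff g f x‖ ^ 2 ∂μ = d⁻¹ * ‖g‖ ^ 2 * ‖f‖ ^ 2) :
    π.IsFormalDegree μ d := by
  have hint (f₁ f₂ g₁ g₂ : H) := integrable_inner_mul_inner (hmem g₁ f₁) (hmem g₂ f₂)
  refine ⟨hd, fun f₁ f₂ g₁ g₂ => ⟨hint f₁ f₂ g₁ g₂, ?_⟩⟩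
  let B : H →ₗ⋆[ℂ] H →ₗ[ℂ] ℂ := LinearMap.mk₂'ₛₗ (starRingEnd ℂ) (RingHom.id ℂ)
    (fun g₁ g₂ => ∫ x, inner ℂ (π x g₁) f₁ * inner ℂ f₂ (π x g₂) ∂μ)
    (fun a b g₂ => by
      simp only [map_add, inner_add_left, add_mul,
        integral_add (hint f₁ f₂ a g₂) (hint f₁ f₂ b g₂)])
    (fun k a g₂ => by
      simp only [map_smul, inner_smul_left, mul_assoc, integral_const_mul, smul_eq_mul])
    (fun g₁ a b => by
      simp only [map_add, inner_add_right, mul_add,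
        integral_add (hint f₁ f₂ g₁ a) (hint f₁ f₂ g₁ b)])
    (fun k g₁ a => by
      simp only [map_smul, inner_smul_right, mul_left_comm _ k, integral_const_mul, smul_eq_mul,
        RingHom.id_apply])
  have hB : B = ((d : ℂ)⁻¹ * inner ℂ f₂ f₁) • innerₛₗ ℂ := sesquilinear_ext_diag fun g => by
    change ∫ x, inner ℂ (π x g) f₁ * inner ℂ f₂ (π x g) ∂μ = (d : ℂ)⁻¹ * inner ℂ f₂ f₁ * inner ℂ g g
    rw [integral_inner_mul_inner_of_norm_sq (hmem g) (hnorm g), inner_self_eq_norm_sq_to_K]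
    push_cast
    exact mul_right_comm _ _ _
  rw [inner_conj_symm]
  exact congrArg (fun B : H →ₗ⋆[ℂ] H →ₗ[ℂ] ℂ => B g₁ g₂) hB

theorem IsFormalDegree.memLp_coeff {d : ℝ} (hd : π.IsFormalDegree μ d) (g f : H) :
    MemLp (π.coeff g f) 2 μ := by
  have h := (hd.2 f f g g).1
  simp only [inner_mul_inner_swap] at h
  exact (memLp_two_iff_integrable_sq_norm
    (π.stronglyMeasurable_coeff g f).aestronglyMeasurable).2 h.re

theorem IsFormalDegree.integral_norm_coeff_sq {d : ℝ} (hd : π.IsFormalDegree μ d) (g f : H) :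
    ∫ x, ‖π.coeff g f x‖ ^ 2 ∂μ = d⁻¹ * ‖f‖ ^ 2 * ‖g‖ ^ 2 := by
  have h := (hd.2 f f g g).2
  simp only [inner_mul_inner_swap, integral_complex_ofReal, inner_self_eq_norm_sq_to_K,
    Complex.coe_algebraMap, map_pow, Complex.conj_ofReal] at h
  exact_mod_cast h

end FormalDegree

section DiscreteSeries

variable {G : Type*} [Group G] [TopologicalSpace G] [IsTopologicalGroup G]
  [LocallyCompactSpace G] [SecondCountableTopology G] [MeasurableSpace G] [BorelSpace G]
  {μ : Measure G} {H : Type*} [NormedAddCommGroup H] [InnerProductSpace ℂ H]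
  {π : ProjectiveRep G H}

theorem integral_norm_coeff_self_sq_pos [μ.IsOpenPosMeasure] {u : H} (hu : u ≠ 0)
    (hmem : MemLp (π.coeff u u) 2 μ) : 0 < ∫ x, ‖π.coeff u u x‖ ^ 2 ∂μ := by
  refine integral_pos_of_integrable_nonneg_nonzero (x := 1) ((π.continuous_norm_coeff u u).pow 2)
    ((memLp_two_iff_integrable_sq_norm hmem.1).1 hmem) (fun x => by positivity) ?_
  obtain ⟨c, hc⟩ := π.exists_map_one
  simp [coeff, hc, hu]

theorem IsDiscreteSeries.exists_isFormalDegree [CompleteSpace H] [μ.IsOpenPosMeasure]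
    [μ.IsMulLeftInvariant] [μ.IsInvInvariant] (hπ : π.IsDiscreteSeries μ) :
    ∃ d : ℝ, π.IsFormalDegree μ d := by
  obtain ⟨hirr, u, hu, hfin⟩ := hπ
  have huu : MemLp (π.coeff u u) 2 μ := by
    refine ⟨(π.stronglyMeasurable_coeff u u).aestronglyMeasurable, ?_⟩
    refine (eLpNorm_lt_top_iff_lintegral_rpow_enorm_lt_top (by simp) (by simp)).2 ?_
    simpa using hfin
  obtain ⟨C, hC⟩ := hirr.exists_integral_norm_coeff_sq hu huu
  have hCpos : 0 < C := by
    have h := integral_norm_coeff_self_sq_pos hu huu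
    rw [(hC u).2] at h
    exact pos_of_mul_pos_left h (by positivity)
  choose D hD using fun g =>
    hirr.exists_integral_norm_coeff_sq hu (memLp_coeff_swap (hC g).1)
  refine ⟨‖u‖ ^ 2 / C, isFormalDegree_of_integral_norm_coeff_sq (by positivity)
    (fun g f => (hD g f).1) fun g f => ?_⟩
  have hDu := (hD g u).2
  rw [integral_norm_coeff_sq_swap, (hC g).2] at hDu
  rw [(hD g f).2, inv_div, div_mul_eq_mul_div, hDu, mul_div_cancel_right₀ _ (by positivity)]

end DiscreteSeries

end ProjectiveRep

section RelativelySeparated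

theorem encard_le_of_forall_finset {α : Type*} {s : Set α} {N : ℕ}
    (h : ∀ v : Finset α, (v : Set α) ⊆ s → v.card ≤ N) : s.encard ≤ N := by
  by_contra! hlt
  obtain ⟨t, hts, ht⟩ := Set.exists_subset_encard_eq (Order.add_one_le_of_lt hlt)
  lift t to Finset α using Set.finite_of_encard_eq_coe (k := N + 1) ht
  rw [Set.encard_coe_eq_coe_finsetCard] at ht
  have hcard : t.card = N + 1 := by exact_mod_cast ht
  exact absurd (h t hts) (by lia)

variable {G : Type*} [Group G] [TopologicalSpace G]

/-- Relatively separated sets: the number of points in the translates of some compact unit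
neighbourhood is bounded. -/
def IsRelativelySeparated (Λ : Set G) : Prop :=
  ∃ U ∈ 𝓝 (1 : G), IsCompact U ∧ ∃ N : ℕ, ∀ x : G, (Λ ∩ x • U).encard ≤ N

/-- Relatively dense sets: some compact set has all its translates met by `Λ`. -/
def IsRelativelyDense (Λ : Set G) : Prop :=
  ∃ C : Set G, IsCompact C ∧ ∀ y : G, (Λ ∩ y • C).Nonempty

namespace IsRelativelySeparated

variable {Λ : Set G} (hΛ : IsRelativelySeparated Λ)

include hΛ

theorem finite_inter [ContinuousMul G] {K : Set G} (hK : IsCompact K) : (Λ ∩ K).Finite := by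
  obtain ⟨U, hU, -, N, hN⟩ := hΛ
  obtain ⟨t, -, hKt⟩ := hK.elim_nhds_subcover (fun x => x • U) fun x _ => smul_mem_nhds_self.2 hU
  refine (t.finite_toSet.biUnion fun x _ => Set.finite_of_encard_le_coe (hN x)).subset ?_
  rw [← Set.inter_iUnion₂]
  exact Set.inter_subset_inter_right _ hKt

theorem countable [ContinuousMul G] [SigmaCompactSpace G] : Λ.Countable := by
  rw [← Set.inter_univ Λ, ← iUnion_compactCovering, Set.inter_iUnion]
  exact Set.countable_iUnion fun n => (hΛ.finite_inter (isCompact_compactCovering G n)).countable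

theorem upperDensity_lt_top [MeasurableSpace G] (μ : Measure G) [μ.IsOpenPosMeasure] :
    upperDensity μ Λ < ∞ := by
  obtain ⟨U, hU, hUc, N, hN⟩ := hΛ
  have hU0 : μ U ≠ 0 := (Measure.measure_pos_of_mem_nhds μ hU).ne'
  suffices upperDensity μ Λ ≤ N / μ U from this.trans_lt (ENNReal.div_lt_top (by simp) hU0)
  refine iInf₂_le_of_le U hUc (iInf_le_of_le hU0 (iSup_le fun x => ?_))
  gcongr
  exact_mod_cast hN x

end IsRelativelySeparated

theorem IsRelativelyDense.lowerDensity_pos [LocallyCompactSpace G] [MeasurableSpace G] {Λ : Set G}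
    (hΛ : IsRelativelyDense Λ) (μ : Measure G) [μ.IsOpenPosMeasure] [IsFiniteMeasureOnCompacts μ] :
    0 < lowerDensity μ Λ := by
  obtain ⟨C, hC, hmeets⟩ := hΛ
  obtain ⟨U, hUc, hU⟩ := exists_compact_mem_nhds (1 : G)
  have hCU : IsCompact (C ∪ U) := hC.union hUc
  have h0 : μ (C ∪ U) ≠ 0 :=
    (Measure.measure_pos_of_mem_nhds μ (mem_of_superset hU Set.subset_union_right)).ne'
  suffices 1 / μ (C ∪ U) ≤ lowerDensity μ Λ from
    (ENNReal.div_pos one_ne_zero hCU.measure_ne_top).trans_le this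
  refine le_iSup₂_of_le (C ∪ U) hCU (le_iSup_of_le h0 (le_iInf fun y => ?_))
  gcongr
  have hne : (Λ ∩ y • (C ∪ U)).Nonempty :=
    (hmeets y).mono (Set.inter_subset_inter_right _ (Set.smul_set_mono Set.subset_union_left))
  exact_mod_cast Set.one_le_encard_iff_nonempty.2 hne

end RelativelySeparated

section Sampling

theorem exists_isCompact_setLIntegral_compl_lt {X : Type*} [TopologicalSpace X] [T2Space X]
    [LocallyCompactSpace X] [SecondCountableTopology X] [MeasurableSpace X] [BorelSpace X]
    {μ : Measure X} {h : X → ℝ≥0∞} (hfin : ∫⁻ x, h x ∂μ ≠ ∞) {ε : ℝ≥0∞} (hε : ε ≠ 0) :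
    ∃ E : Set X, IsCompact E ∧ ∫⁻ x in Eᶜ, h x ∂μ < ε := by
  have := isFiniteMeasure_withDensity hfin
  obtain ⟨E, -, hE, hlt⟩ := MeasurableSet.univ.exists_isCompact_sdiff_lt
    (measure_ne_top (μ.withDensity h) _) hε
  rw [← Set.compl_eq_univ_sdiff, withDensity_apply _ hE.measurableSet.compl] at hlt
  exact ⟨E, hE, hlt⟩

variable {G : Type*} [Group G] [TopologicalSpace G] [IsTopologicalGroup G] [MeasurableSpace G]
  [BorelSpace G] {μ : Measure G} [μ.IsOpenPosMeasure] {F : G → ℂ} {Q : Set G}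

theorem enorm_le_localMaximal (hF : Continuous fun x => ‖F x‖) {q : G}
    (hq : q ∈ interior Q) (x : G) : ‖F (x * q)‖ₑ ≤ localMaximal μ Q F x := by
  have hcont : Continuous fun z => ‖F (x * z)‖ₑ := by
    simp only [← ofReal_norm]
    exact ENNReal.continuous_ofReal.comp (hF.comp (continuous_const_mul x))
  by_contra! hlt
  obtain ⟨c, hc, hcq⟩ := exists_between hlt
  have hO : IsOpen ({z | c < ‖F (x * z)‖ₑ} ∩ interior Q) :=
    (isOpen_lt continuous_const hcont).inter isOpen_interior
  have hnull : μ.restrict Q ({z | c < ‖F (x * z)‖ₑ} ∩ interior Q) = 0 :=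
    measure_mono_null (fun z hz => not_lt.2 (le_of_lt hz.1)) (ae_iff.1 (ae_lt_of_essSup_lt hc))
  rw [Measure.restrict_apply hO.measurableSet,
    Set.inter_eq_left.2 (Set.inter_subset_right.trans interior_subset)] at hnull
  exact (hO.measure_pos μ ⟨q, hcq, hq⟩).ne' hnull

variable [μ.IsMulLeftInvariant]

theorem tsum_enorm_rpow_mul_measure_le (hF : Continuous fun x => ‖F x‖) {U : Set G}
    (hU : MeasurableSet U) (hUQ : U ⊆ interior Q) {Γ : Set G} (hΓ : Γ.Countable)
    {N : ℕ} (hN : ∀ x : G, (Γ ∩ x • U).encard ≤ N) {E : Set G} (hE : MeasurableSet E)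
    (hΓE : Disjoint Γ (E * U)) {p : ℝ} (hp : 0 ≤ p) :
    (∑' γ : Γ, ‖F γ‖ₑ ^ p) * μ U⁻¹ ≤ N * ∫⁻ x in Eᶜ, localMaximal μ Q F x ^ p ∂μ := by
  set ν := μ.withDensity fun x => localMaximal μ Q F x ^ p
  have hcount (x : G) : ((Γ ∩ x • U).encard : ℝ≥0∞) ≤ N := by exact_mod_cast hN x
  have hterm (γ : Γ) : ‖F γ‖ₑ ^ p * μ U⁻¹ ≤ ν (Eᶜ ∩ (γ : G) • U⁻¹) := by
    have hsub : (γ : G) • U⁻¹ ⊆ Eᶜ := by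
      rintro _ ⟨u, hu, rfl⟩ hmem
      exact Set.disjoint_left.1 hΓE γ.2 ⟨_, hmem, u⁻¹, hu, mul_inv_cancel_right _ _⟩
    rw [Set.inter_eq_right.2 hsub, withDensity_apply _ (hU.inv.const_smul _),
      ← measure_smul μ (γ : G), ← setLIntegral_const]
    refine setLIntegral_mono' (hU.inv.const_smul _) ?_
    rintro _ ⟨u, hu, rfl⟩
    gcongr
    simpa only [smul_eq_mul, mul_inv_cancel_right]
      using enorm_le_localMaximal (μ := μ) hF (hUQ hu) ((γ : G) * u)
  calc (∑' γ : Γ, ‖F γ‖ₑ ^ p) * μ U⁻¹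
      ≤ ∑' γ : Γ, ν (Eᶜ ∩ (γ : G) • U⁻¹) :=
        ENNReal.tsum_mul_right.symm.trans_le (ENNReal.tsum_le_tsum hterm)
    _ = ∫⁻ x in Eᶜ, ((Γ ∩ x • U).encard : ℝ≥0∞) ∂ν :=
        (setLIntegral_encard_inter_smul ν hΓ hU _).symm
    _ ≤ ∫⁻ _ in Eᶜ, (N : ℝ≥0∞) ∂ν := lintegral_mono hcount
    _ = N * ∫⁻ x in Eᶜ, localMaximal μ Q F x ^ p ∂μ := by
        rw [setLIntegral_const, withDensity_apply _ hE.compl]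

theorem IsRelativelySeparated.exists_isCompact_sum_enorm_rpow_le [T2Space G]
    [LocallyCompactSpace G] [SecondCountableTopology G] {Λ : Set G}
    (hΛ : IsRelativelySeparated Λ) (hF : Continuous fun x => ‖F x‖) (hQ : Q ∈ 𝓝 (1 : G)) {p : ℝ}
    (hp : 0 ≤ p) (hfin : ∫⁻ x, localMaximal μ Q F x ^ p ∂μ < ∞) {ε : ℝ≥0∞} (hε : ε ≠ 0) :
    ∃ C : Set G, IsCompact C ∧ ∀ (y : G) (v : Finset Λ), (∀ l ∈ v, (l : G) ∉ y • C) →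
      ∑ l ∈ v, ‖F (y⁻¹ * l)‖ₑ ^ p ≤ ε := by
  classical
  obtain ⟨U, hU, hUc, N, hN⟩ := hΛ
  set W := interior Q ∩ interior U
  have hWU : W ⊆ U := Set.inter_subset_right.trans interior_subset
  have hWo : IsOpen W := isOpen_interior.inter isOpen_interior
  have hW0 : μ W⁻¹ ≠ 0 := (hWo.inv.measure_pos μ ⟨1, by
    simpa [W] using ⟨mem_interior_iff_mem_nhds.2 hQ, mem_interior_iff_mem_nhds.2 hU⟩⟩).ne'
  obtain ⟨δ, hδ, hδε⟩ :=
    ENNReal.exists_nnreal_pos_mul_lt (ENNReal.natCast_ne_top N) (mul_ne_zero hε hW0)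
  obtain ⟨E, hE, hEδ⟩ :=
    exists_isCompact_setLIntegral_compl_lt hfin.ne (ENNReal.coe_ne_zero.2 hδ.ne')
  refine ⟨E * U, hE.mul hUc, fun y v hv => le_of_lt ?_⟩
  -- it suffices to estimate the sum over the translate `y⁻¹ • v`
  set Γ : Finset G := v.image fun l : Λ => y⁻¹ * l
  have hsum : ∑' γ : (Γ : Set G), ‖F γ‖ₑ ^ p = ∑ l ∈ v, ‖F (y⁻¹ * l)‖ₑ ^ p := by
    rw [Finset.tsum_subtype' Γ fun γ => ‖F γ‖ₑ ^ p, Finset.sum_image]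
    exact fun l _ l' _ h => Subtype.ext (mul_left_cancel h)
  have hΓN (x : G) : ((Γ : Set G) ∩ x • W).encard ≤ N := by
    refine le_trans ?_ (hN (y * x))
    rw [← (MulAction.injective y).encard_image, Set.image_smul, Set.smul_set_inter, smul_smul]
    refine Set.encard_le_encard (Set.inter_subset_inter ?_ (Set.smul_set_mono hWU))
    rintro _ ⟨γ, hγ, rfl⟩
    obtain ⟨l, -, rfl⟩ := Finset.mem_image.1 hγ
    simp
  have hΓE : Disjoint (Γ : Set G) (E * W) := by
    refine Set.disjoint_left.2 fun γ hγ hmem => ?_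
    obtain ⟨l, hl, rfl⟩ := Finset.mem_image.1 hγ
    exact hv l hl (Set.mem_smul_set_iff_inv_smul_mem.2 (Set.mul_subset_mul_left hWU hmem))
  have hbound := tsum_enorm_rpow_mul_measure_le (μ := μ) hF hWo.measurableSet
    Set.inter_subset_left Γ.countable_toSet hΓN hE.measurableSet hΓE hp
  rw [hsum] at hbound
  refine lt_of_mul_lt_mul_right' (hbound.trans_lt (lt_of_le_of_lt ?_ hδε))
  rw [mul_comm]
  gcongr

end Sampling

namespace ProjectiveRep

variable {G H : Type*} [Group G] [MeasurableSpace G] [NormedAddCommGroup H]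
  [InnerProductSpace ℂ H] {π : ProjectiveRep G H} {Λ : Set G} {g : H}

theorem isRelativelySeparated_of_isBesselWith [TopologicalSpace G] [IsTopologicalGroup G]
    [LocallyCompactSpace G] [SecondCountableTopology G] [BorelSpace G] {b : ℝ≥0}
    (hb : IsBesselWith (π.coherentSystem Λ g) b) (hg : g ≠ 0) : IsRelativelySeparated Λ := by
  have : 0 < ‖g‖ := norm_pos_iff.2 hg
  have hone : ‖g‖ ^ 2 / 2 < ‖π.coeff g g 1‖ := by
    obtain ⟨c, hc⟩ := π.exists_map_one
    rw [coeff, hc, inner_smul_left, norm_mul, RCLike.norm_conj, Circle.norm_coe, one_mul,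
      inner_self_eq_norm_sq_to_K, norm_pow, RCLike.norm_ofReal, abs_norm]
    exact half_lt_self (by positivity)
  obtain ⟨U, hU, hUsub, hUc⟩ := local_compact_nhds
    ((isOpen_lt continuous_const (π.continuous_norm_coeff g g)).mem_nhds hone)
  refine ⟨U, hU, hUc, ⌊(b * ‖g‖) ^ 2 / (‖g‖ ^ 2 / 2) ^ 2⌋₊, fun x => ?_⟩
  rw [← Subtype.image_preimage_coe, Subtype.val_injective.encard_image]
  refine encard_le_of_forall_finset fun v hv => Nat.le_floor ?_
  rw [le_div_iff₀ (by positivity), ← nsmul_eq_mul, ← (π x).norm_map g]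
  refine (Finset.card_nsmul_le_sum _ _ _ fun l hl => ?_).trans (hb (π x g) v)
  have hl' : x⁻¹ * (l : G) ∈ U := Set.mem_smul_set_iff_inv_smul_mem.1 (hv hl)
  rw [coherentSystem, norm_inner_map_map, (π x).norm_map]
  have hlow : ‖g‖ ^ 2 / 2 < ‖inner ℂ (π (x⁻¹ * l) g) g‖ := hUsub hl'
  gcongr

variable (π Λ g) in
/-- The coefficients `(⟨π(y) g, π(λ) g⟩)_{λ ∈ Λ}` have uniformly small `ℓ²` tails outside compact
neighbourhoods `y C` of the point `y`. -/
def HasUniformTails [TopologicalSpace G] : Prop :=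
  ∀ ε > 0, ∃ C : Set G, IsCompact C ∧ ∀ (y : G) (v : Finset Λ), (∀ l ∈ v, (l : G) ∉ y • C) →
    ∑ l ∈ v, ‖inner ℂ (π l g) (π y g)‖ ^ 2 ≤ ε ^ 2

theorem MemB2.hasUniformTails [TopologicalSpace G] [IsTopologicalGroup G] [T2Space G]
    [LocallyCompactSpace G] [SecondCountableTopology G] [BorelSpace G] {μ : Measure G}
    [μ.IsMulLeftInvariant] [μ.IsOpenPosMeasure] {Q : Set G} (hg : π.MemB2 μ Q g)
    (hQ : Q ∈ 𝓝 (1 : G)) (hΛ : IsRelativelySeparated Λ) : π.HasUniformTails Λ g := by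
  intro ε hε
  obtain ⟨C, hC, htail⟩ := hΛ.exists_isCompact_sum_enorm_rpow_le (π.continuous_norm_coeff g g) hQ
    zero_le_two hg.lintegral_lt_top (ENNReal.ofReal_pos.2 (pow_pos hε 2)).ne'
  refine ⟨C, hC, fun y v hv => (ENNReal.ofReal_le_ofReal_iff (by positivity)).1 ?_⟩
  rw [ENNReal.ofReal_sum_of_nonneg fun _ _ => by positivity]
  refine le_of_eq_of_le (Finset.sum_congr rfl fun l _ => ?_) (htail y v hv)
  rw [norm_inner_map_map, ENNReal.ofReal_pow (norm_nonneg _), ofReal_norm, ENNReal.rpow_two, coeff]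

theorem HasUniformTails.isRelativelyDense [TopologicalSpace G] (htail : π.HasUniformTails Λ g)
    {h : Λ → H} {b : ℝ≥0} (hh : IsBesselWith h b) (hdual : IsDualFamily (π.coherentSystem Λ g) h)
    (hg : g ≠ 0) : IsRelativelyDense Λ := by
  have hg' : 0 < ‖g‖ := norm_pos_iff.2 hg
  set ε : ℝ := ‖g‖ / (b + 1)
  obtain ⟨C, hC, hCε⟩ := htail ε (by positivity)
  refine ⟨C, hC, fun y => ?_⟩
  by_contra hempty
  rw [Set.not_nonempty_iff_eq_empty] at hempty
  have hsmall := norm_sub_sum_mul_le_of_hasSum (hdual.hasSum_inner (π y g) (π y g)) ∅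
    (β := ε) (by positivity) (by positivity) (hh (π y g)) fun v _ => by
      simp only [norm_inner_symm (π y g)]
      exact hCε y v fun l _ hl => Set.notMem_empty (l : G) (hempty ▸ ⟨l.2, hl⟩)
  rw [Finset.sum_empty, sub_zero, inner_self_eq_norm_sq_to_K, norm_pow, RCLike.norm_ofReal,
    abs_norm, (π y).norm_map] at hsmall
  have hbε : b * ‖g‖ * ε < ‖g‖ ^ 2 := by
    rw [mul_div_assoc', div_lt_iff₀ (by positivity)]
    nlinarith [pow_pos hg' 2]
  exact hbε.not_ge hsmall

end ProjectiveRep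

theorem norm_integral_mul_le_of_integral_norm_sq_le {X : Type*} [MeasurableSpace X] {μ : Measure X}
    {a b : X → ℂ} (ha : MemLp a 2 μ) (hb : MemLp b 2 μ) {α β : ℝ} (hα : 0 ≤ α) (hβ : 0 ≤ β)
    (haα : ∫ x, ‖a x‖ ^ 2 ∂μ ≤ α ^ 2) (hbβ : ∫ x, ‖b x‖ ^ 2 ∂μ ≤ β ^ 2) :
    ‖∫ x, a x * b x ∂μ‖ ≤ α * β := by
  have htwo : (2 : ℝ≥0∞) = ENNReal.ofReal 2 := by simp
  have hcauchy := integral_mul_norm_le_Lp_mul_Lq Real.HolderConjugate.two_two (htwo ▸ ha)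
    (htwo ▸ hb)
  simp only [Real.rpow_two, ← Real.sqrt_eq_rpow] at hcauchy
  calc ‖∫ x, a x * b x ∂μ‖ ≤ ∫ x, ‖a x‖ * ‖b x‖ ∂μ := by
        simpa only [norm_mul] using norm_integral_le_integral_norm fun x => a x * b x
    _ ≤ √(∫ x, ‖a x‖ ^ 2 ∂μ) * √(∫ x, ‖b x‖ ^ 2 ∂μ) := hcauchy
    _ ≤ α * β := mul_le_mul (Real.sqrt_le_left hα |>.2 haα) (Real.sqrt_le_left hβ |>.2 hbβ)
        (Real.sqrt_nonneg _) hα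

theorem sum_indicator_const_eq_ncard_mul {α : Type*} {Λ S : Set α} {t : Finset Λ}
    (ht : ∀ l : Λ, (l : α) ∈ S → l ∈ t) (c : ℝ) :
    ∑ l ∈ t, S.indicator (fun _ => c) (l : α) = (Λ ∩ S).ncard * c := by
  classical
  have hS : (Subtype.val ⁻¹' S : Set Λ) = (t.filter fun l : Λ => (l : α) ∈ S : Finset Λ) := by
    ext l
    simpa using ht l
  rw [← Subtype.image_preimage_coe, Set.ncard_image_of_injective _ Subtype.val_injective, hS,
    Set.ncard_coe_finset, Finset.sum_indicator_eq_sum_filter, Finset.sum_const, nsmul_eq_mul]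

namespace ProjectiveRep

variable {G H : Type*} [Group G] [MeasurableSpace G] [NormedAddCommGroup H]
  [InnerProductSpace ℂ H] {π : ProjectiveRep G H} {μ : Measure G} {Λ : Set G} {g : H}

theorem IsFormalDegree.norm_setIntegral_inner_mul_inner_le {d : ℝ} (hd : π.IsFormalDegree μ d)
    (f u : H) {s : Set G} {β : ℝ} (hβ : 0 ≤ β) (hs : ∫ y in s, ‖π.coeff g f y‖ ^ 2 ∂μ ≤ β ^ 2) :
    ‖∫ y in s, inner ℂ (π y g) f * inner ℂ u (π y g) ∂μ‖ ≤ β * (‖u‖ * ‖g‖ / √d) := by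
  have hu := hd.memLp_coeff g u
  have hmem : MemLp (fun y => inner ℂ u (π y g)) 2 μ :=
    hu.congr_norm (stronglyMeasurable_const.inner (π.stronglyMeasurable g)).aestronglyMeasurable
      (Eventually.of_forall fun y => norm_inner_symm _ _)
  have hd0 := hd.1
  refine norm_integral_mul_le_of_integral_norm_sq_le ((hd.memLp_coeff g f).restrict s)
    (hmem.restrict s) hβ (by positivity) hs ?_
  calc ∫ y in s, ‖inner ℂ u (π y g)‖ ^ 2 ∂μ = ∫ y in s, ‖π.coeff g u y‖ ^ 2 ∂μ := by
        simp only [norm_inner_symm u, coeff]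
    _ ≤ ∫ y, ‖π.coeff g u y‖ ^ 2 ∂μ := setIntegral_le_integral
        ((memLp_two_iff_integrable_sq_norm hu.1).1 hu) (Eventually.of_forall fun y => by positivity)
    _ = (‖u‖ * ‖g‖ / √d) ^ 2 := by
        rw [hd.integral_norm_coeff_sq, div_pow, Real.sq_sqrt hd0.le]
        ring

variable (π μ Λ g) in
/-- The window `C` captures the coefficients `⟨π(y) g, π(x) g⟩` up to an `L²`-error `η`, both when
`x` runs over `Λ` outside a translate `y C` and when `y` runs over `G` outside a translate `x C`. -/
structure IsLocalizedBy (C : Set G) (η : ℝ) : Prop where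
  sum_le : ∀ (y : G) (v : Finset Λ), (∀ l ∈ v, (l : G) ∉ y • C) →
    ∑ l ∈ v, ‖inner ℂ (π l g) (π y g)‖ ^ 2 ≤ η ^ 2
  setIntegral_le : ∀ x : G, ∫ y in (x • C)ᶜ, ‖π.coeff g (π x g) y‖ ^ 2 ∂μ ≤ η ^ 2

section Tightness

variable [TopologicalSpace G] [IsTopologicalGroup G] [T2Space G] [LocallyCompactSpace G]
  [SecondCountableTopology G] [BorelSpace G] [μ.IsMulLeftInvariant]

theorem exists_isCompact_setIntegral_compl_smul_le (hg : MemLp (π.coeff g g) 2 μ) {ε : ℝ}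
    (hε : 0 < ε) :
    ∃ C : Set G, IsCompact C ∧ ∀ x : G, ∫ y in (x • C)ᶜ, ‖π.coeff g (π x g) y‖ ^ 2 ∂μ ≤ ε := by
  have hint := (memLp_two_iff_integrable_sq_norm hg.1).1 hg
  have hnonneg (s : Set G) : 0 ≤ᵐ[μ.restrict s] fun y => ‖π.coeff g g y‖ ^ 2 :=
    Eventually.of_forall fun y => by positivity
  obtain ⟨C, hC, hlt⟩ := exists_isCompact_setLIntegral_compl_lt
    hint.lintegral_lt_top.ne (ENNReal.ofReal_pos.2 hε).ne'
  rw [← ofReal_integral_eq_lintegral_ofReal hint.integrableOn (hnonneg _)] at hlt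
  refine ⟨C, hC, fun x => ?_⟩
  have htranslate : (x • C)ᶜ = (x⁻¹ * ·) ⁻¹' Cᶜ := by
    rw [← Set.smul_set_compl]
    exact (Set.preimage_smul_inv x Cᶜ).symm
  calc ∫ y in (x • C)ᶜ, ‖π.coeff g (π x g) y‖ ^ 2 ∂μ
      = ∫ y in (x⁻¹ * ·) ⁻¹' Cᶜ, ‖π.coeff g g (x⁻¹ * y)‖ ^ 2 ∂μ := by
        simp only [coeff, norm_inner_map_map, htranslate]
    _ = ∫ y in Cᶜ, ‖π.coeff g g y‖ ^ 2 ∂μ :=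
        (measurePreserving_mul_left μ x⁻¹).setIntegral_preimage_emb
          (measurableEmbedding_mulLeft x⁻¹) (fun y => ‖π.coeff g g y‖ ^ 2) _
    _ ≤ ε := ((ENNReal.ofReal_lt_ofReal_iff hε).1 hlt).le

theorem HasUniformTails.exists_isLocalizedBy (htail : π.HasUniformTails Λ g)
    (hg : ∀ f, MemLp (π.coeff g f) 2 μ) {η : ℝ} (hη : 0 < η) :
    ∃ C : Set G, IsCompact C ∧ π.IsLocalizedBy μ Λ g C η := by
  obtain ⟨C, hC, hsum⟩ := htail η hη
  obtain ⟨C', hC', hint⟩ := exists_isCompact_setIntegral_compl_smul_le (hg g) (pow_pos hη 2)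
  refine ⟨C ∪ C', hC.union hC', fun y v hv => hsum y v fun l hl hmem => hv l hl ?_, fun x => ?_⟩
  · exact Set.smul_set_mono Set.subset_union_left hmem
  · refine (setIntegral_mono_set ?_ (Eventually.of_forall fun y => by positivity)
      (Set.compl_subset_compl.2 (Set.smul_set_mono Set.subset_union_right)).eventuallyLE).trans
      (hint x)
    exact ((memLp_two_iff_integrable_sq_norm (hg _).1).1 (hg _)).integrableOn

end Tightness

section Localization

variable {d : ℝ} (hd : π.IsFormalDegree μ d) {h : Λ → H} {b b' : ℝ≥0} {P C : Set G} {η : ℝ}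

include hd in
theorem IsFormalDegree.sum_inner_sub_eq (hP : MeasurableSet P) (hPfin : μ P ≠ ∞) (t : Finset Λ) :
    (d : ℂ)⁻¹ * ‖g‖ ^ 2 * ∑ l ∈ t, inner ℂ (h l) (π l g) - ‖g‖ ^ 2 * μ.real P
      = ∑ l ∈ t, ∫ y in Pᶜ, inner ℂ (π y g) (π l g) * inner ℂ (h l) (π y g) ∂μ
        - ∫ y in P, (‖g‖ ^ 2 - ∑ l ∈ t, inner ℂ (π y g) (π l g) * inner ℂ (h l) (π y g)) ∂μ := by
  have hint (l : Λ) := (hd.2 (π l g) (h l) g g).1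
  have hvalue : ∑ l ∈ t, ∫ y, inner ℂ (π y g) (π l g) * inner ℂ (h l) (π y g) ∂μ
      = (d : ℂ)⁻¹ * ‖g‖ ^ 2 * ∑ l ∈ t, inner ℂ (h l) (π l g) := by
    rw [Finset.mul_sum]
    refine Finset.sum_congr rfl fun l _ => ?_
    rw [(hd.2 (π l g) (h l) g g).2, inner_conj_symm, inner_self_eq_norm_sq_to_K]
    exact mul_right_comm _ _ _
  have hsplit : ∑ l ∈ t, ∫ y, inner ℂ (π y g) (π l g) * inner ℂ (h l) (π y g) ∂μ
      = ∑ l ∈ t, ∫ y in P, inner ℂ (π y g) (π l g) * inner ℂ (h l) (π y g) ∂μ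
        + ∑ l ∈ t, ∫ y in Pᶜ, inner ℂ (π y g) (π l g) * inner ℂ (h l) (π y g) ∂μ := by
    rw [← Finset.sum_add_distrib]
    exact Finset.sum_congr rfl fun l _ => (integral_add_compl hP (hint l)).symm
  have hconst : IntegrableOn (fun _ => (‖g‖ : ℂ) ^ 2) P μ := integrableOn_const hPfin
  rw [integral_sub hconst
    (integrable_finsetSum _ fun l _ => (hint l).integrableOn), setIntegral_const,
    Complex.real_smul, integral_finsetSum _ fun l _ => (hint l).integrableOn]
  linear_combination hsplit - hvalue

include hd in
theorem IsFormalDegree.norm_setIntegral_compl_le (hloc : π.IsLocalizedBy μ Λ g C η) (hη : 0 ≤ η)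
    {x : G} (hx : x ∈ P) (u : H) :
    ‖∫ y in Pᶜ, inner ℂ (π y g) (π x g) * inner ℂ u (π y g) ∂μ‖
      ≤ (η + (innerBoundary P C⁻¹).indicator (fun _ => ‖g‖ ^ 2 / √d) x)
        * (‖u‖ * ‖g‖ / √d) := by
  have hd0 := hd.1
  have hmem := hd.memLp_coeff g (π x g)
  have hint := (memLp_two_iff_integrable_sq_norm hmem.1).1 hmem
  have hnonneg : 0 ≤ᵐ[μ] fun y => ‖π.coeff g (π x g) y‖ ^ 2 :=
    Eventually.of_forall fun y => by positivity
  by_cases hxb : x ∈ innerBoundary P C⁻¹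
  · rw [Set.indicator_of_mem hxb]
    refine hd.norm_setIntegral_inner_mul_inner_le _ _ (by positivity) ?_
    calc ∫ y in Pᶜ, ‖π.coeff g (π x g) y‖ ^ 2 ∂μ ≤ ∫ y, ‖π.coeff g (π x g) y‖ ^ 2 ∂μ :=
          setIntegral_le_integral hint hnonneg
      _ = (‖g‖ ^ 2 / √d) ^ 2 := by
          rw [hd.integral_norm_coeff_sq, div_pow, Real.sq_sqrt hd0.le, (π x).norm_map]
          ring
      _ ≤ (η + ‖g‖ ^ 2 / √d) ^ 2 := by
          gcongr
          exact le_add_of_nonneg_left hη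
  · rw [Set.indicator_of_notMem hxb, add_zero]
    refine hd.norm_setIntegral_inner_mul_inner_le _ _ hη ((setIntegral_mono_set hint.integrableOn
      (ae_restrict_of_ae hnonneg) ?_).trans (hloc.setIntegral_le x))
    exact (Set.compl_subset_compl.2 (smul_subset_of_notMem_innerBoundary hx hxb)).eventuallyLE

theorem IsLocalizedBy.norm_norm_sq_sub_sum_le (hloc : π.IsLocalizedBy μ Λ g C η) (hη : 0 ≤ η)
    (he : IsBesselWith (π.coherentSystem Λ g) b) (hh : IsBesselWith h b')
    (hdual : IsDualFamily (π.coherentSystem Λ g) h) {t : Finset Λ}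
    (ht : ∀ l, l ∈ t ↔ (l : G) ∈ P) {y : G} (hy : y ∈ P) :
    ‖(‖g‖ : ℂ) ^ 2 - ∑ l ∈ t, inner ℂ (π y g) (π l g) * inner ℂ (h l) (π y g)‖
      ≤ b' * ‖g‖ * (η + (innerBoundary P C⁻¹).indicator (fun _ => b * ‖g‖) y) := by
  have hrepr : HasSum (fun l : Λ => inner ℂ (h l) (π y g) * inner ℂ (π y g) (π l g))
      ((‖g‖ : ℂ) ^ 2) := by
    have hinner := hdual.hasSum_inner (π y g) (π y g)
    rwa [inner_self_eq_norm_sq_to_K, (π y).norm_map] at hinner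
  have hindicator : 0 ≤ (innerBoundary P C⁻¹).indicator (fun _ => b * ‖g‖) y :=
    Set.indicator_nonneg (fun _ _ => by positivity) y
  simp only [mul_comm (inner ℂ (π y g) _)]
  refine norm_sub_sum_mul_le_of_hasSum hrepr t (by positivity) (by positivity)
    (fun v => (hh _ v).trans_eq (by rw [(π y).norm_map])) fun v hv => ?_
  simp only [norm_inner_symm (π y g)]
  by_cases hyb : y ∈ innerBoundary P C⁻¹
  · rw [Set.indicator_of_mem hyb]
    refine (he _ v).trans ?_
    rw [(π y).norm_map]
    gcongr
    exact le_add_of_nonneg_left hη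
  · rw [Set.indicator_of_notMem hyb, add_zero]
    refine hloc.sum_le y v fun l hl hmem => Finset.disjoint_left.1 hv hl ((ht l).2 ?_)
    exact smul_subset_of_notMem_innerBoundary hy hyb hmem

variable (he : IsBesselWith (π.coherentSystem Λ g) b) (hh : IsBesselWith h b')
  (hdual : IsDualFamily (π.coherentSystem Λ g) h)

include hd he hh hdual

theorem IsFormalDegree.norm_sum_inner_sub_le (hloc : π.IsLocalizedBy μ Λ g C η) (hη : 0 ≤ η)
    (hP : MeasurableSet P) (hPfin : μ P ≠ ∞) (hbd : MeasurableSet (innerBoundary P C⁻¹))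
    {t : Finset Λ} (ht : ∀ l, l ∈ t ↔ (l : G) ∈ P) :
    ‖(d : ℂ)⁻¹ * ‖g‖ ^ 2 * ∑ l ∈ t, inner ℂ (h l) (π l g) - ‖g‖ ^ 2 * μ.real P‖
      ≤ (η * (Λ ∩ P).ncard + ‖g‖ ^ 2 / √d * (Λ ∩ innerBoundary P C⁻¹).ncard)
          * (b' * ‖g‖ / √d)
        + b' * ‖g‖ * (η * μ.real P + b * ‖g‖ * μ.real (innerBoundary P C⁻¹)) := by
  rw [hd.sum_inner_sub_eq hP hPfin]
  refine (norm_sub_le _ _).trans (add_le_add ?_ ?_)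
  · calc ‖∑ l ∈ t, ∫ y in Pᶜ, inner ℂ (π y g) (π l g) * inner ℂ (h l) (π y g) ∂μ‖
        ≤ ∑ l ∈ t, (P.indicator (fun _ => η) (l : G)
            + (innerBoundary P C⁻¹).indicator (fun _ => ‖g‖ ^ 2 / √d) (l : G))
            * (b' * ‖g‖ / √d) := by
          refine norm_sum_le_of_le _ fun l hl => ?_
          have hlP := (ht l).1 hl
          rw [Set.indicator_of_mem hlP]
          have hpos : 0 ≤ (innerBoundary P C⁻¹).indicator (fun _ => ‖g‖ ^ 2 / √d) (l : G) :=
            Set.indicator_nonneg (fun _ _ => by positivity) _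
          refine (hd.norm_setIntegral_compl_le hloc hη hlP (h l)).trans ?_
          gcongr
          exact hh.norm_le l
      _ = _ := by
          rw [← Finset.sum_mul, Finset.sum_add_distrib,
            sum_indicator_const_eq_ncard_mul fun l hl => (ht l).2 hl,
            sum_indicator_const_eq_ncard_mul fun l hl => (ht l).2 (innerBoundary_subset _ _ hl),
            mul_comm η, mul_comm (‖g‖ ^ 2 / √d)]
  · have hconst (k : ℝ) : Integrable (fun _ : G => k) (μ.restrict P) := integrableOn_const hPfin
    refine (norm_integral_le_of_norm_le
      (((hconst _).add ((hconst _).indicator hbd)).const_mul _) ((ae_restrict_iff' hP).2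
      (Eventually.of_forall fun y => hloc.norm_norm_sq_sub_sum_le hη he hh hdual ht))).trans_eq ?_
    simp only [Pi.add_apply]
    rw [integral_const_mul, integral_add (hconst _) ((hconst _).indicator hbd), setIntegral_const,
      integral_indicator_const _ hbd, smul_eq_mul, smul_eq_mul, measureReal_restrict_apply hbd,
      Set.inter_eq_left.2 (innerBoundary_subset _ _), mul_comm η, mul_comm (b * ‖g‖)]

theorem IsFormalDegree.exists_abs_sum_re_inner_sub_le (hg : g ≠ 0) :
    ∃ X ≥ 0, ∀ {C : Set G} {η : ℝ}, π.IsLocalizedBy μ Λ g C η → 0 ≤ η → ∀ {P : Set G},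
      MeasurableSet P → μ P ≠ ∞ → MeasurableSet (innerBoundary P C⁻¹) →
      ∀ {t : Finset Λ}, (∀ l, l ∈ t ↔ (l : G) ∈ P) →
      |∑ l ∈ t, (inner ℂ (h l) (π l g)).re - d * μ.real P|
        ≤ X * (η * ((Λ ∩ P).ncard + μ.real P)
          + ((Λ ∩ innerBoundary P C⁻¹).ncard + μ.real (innerBoundary P C⁻¹))) := by
  have hd0 := hd.1
  have : 0 < ‖g‖ := norm_pos_iff.2 hg
  set M : ℝ := b' * ‖g‖ / √d
  set M' : ℝ := b' * ‖g‖
  have : 0 ≤ M := by positivity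
  have : 0 ≤ M' := by positivity
  refine ⟨d / ‖g‖ ^ 2 * (M + M' + (M * (‖g‖ ^ 2 / √d) + M' * (b * ‖g‖))), by positivity, ?_⟩
  intro C η hloc hη P hP hPfin hbd t ht
  have hbound := hd.norm_sum_inner_sub_le he hh hdual hloc hη hP hPfin hbd ht
  have hre : |∑ l ∈ t, (inner ℂ (h l) (π l g)).re - d * μ.real P|
      = d / ‖g‖ ^ 2 * |((d : ℂ)⁻¹ * ‖g‖ ^ 2 * ∑ l ∈ t, inner ℂ (h l) (π l g)
        - ‖g‖ ^ 2 * μ.real P).re| := by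
    have hcast : (d : ℂ)⁻¹ * ‖g‖ ^ 2 * ∑ l ∈ t, inner ℂ (h l) (π l g) - ‖g‖ ^ 2 * μ.real P
        = ((d⁻¹ * ‖g‖ ^ 2 : ℝ) : ℂ) * ∑ l ∈ t, inner ℂ (h l) (π l g)
          - ((‖g‖ ^ 2 * μ.real P : ℝ) : ℂ) := by push_cast; rfl
    rw [hcast, Complex.sub_re, Complex.re_ofReal_mul, Complex.ofReal_re, Complex.re_sum,
      ← abs_of_pos (a := d / ‖g‖ ^ 2) (by positivity), ← abs_mul]
    congr 1
    field_simp
  rw [hre, mul_assoc (d / ‖g‖ ^ 2)]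
  refine mul_le_mul_of_nonneg_left ((Complex.abs_re_le_norm _).trans (hbound.trans ?_))
    (by positivity)
  set q := ‖g‖ ^ 2 / √d
  set r := b * ‖g‖
  set a := ((Λ ∩ P).ncard : ℝ)
  set c := ((Λ ∩ innerBoundary P C⁻¹).ncard : ℝ)
  set m := μ.real P
  set m' := μ.real (innerBoundary P C⁻¹)
  have hslack : 0 ≤ M * η * m + M' * η * a + (M * q + M' * r) * (η * (a + m))
      + (M + M') * (c + m') + M * q * m' + M' * r * c := by positivity
  linear_combination hslack

end Localization

end ProjectiveRep

section UniformQuotients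

variable {ι X : Type*} {l : Filter ι} {s T : ι → X → ℝ} {d D : ℝ}

theorem tendsto_sub_div_add (d : ℝ) (hD : 0 < D) :
    Tendsto (fun ε : ℝ => (d - ε) / (D + ε)) (𝓝 0) (𝓝 (d / D)) := by
  have hcont : ContinuousAt (fun ε : ℝ => (d - ε) / (D + ε)) 0 :=
    (by fun_prop : ContinuousAt (fun ε : ℝ => d - ε) 0).div (by fun_prop) (by simpa using hD.ne')
  simpa using hcont.tendsto

theorem exists_pos_lt_sub_div_add (hd : 0 < d) (hD : 0 < D) {a : ℝ} (ha : a < d / D) :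
    ∃ ε > 0, ε < d ∧ a < (d - ε) / (D + ε) := by
  have hev := (eventually_lt_nhds hd).and ((tendsto_sub_div_add d hD).eventually_const_lt ha)
  exact ((eventually_mem_nhdsWithin (s := Set.Ioi 0)).and (hev.filter_mono inf_le_left)).exists

theorem exists_pos_add_div_sub_lt (hD : 0 < D) {a : ℝ} (ha : d / D < a) :
    ∃ ε > 0, ε < D ∧ (d + ε) / (D - ε) < a := by
  have hlim : Tendsto (fun ε : ℝ => (d + ε) / (D - ε)) (𝓝 0) (𝓝 (d / D)) := by
    simpa [Function.comp_def, ← sub_eq_add_neg]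
      using (tendsto_sub_div_add d hD).comp (continuous_neg.tendsto' (0 : ℝ) 0 neg_zero)
  have hev := (eventually_lt_nhds hD).and (hlim.eventually_lt_const ha)
  exact ((eventually_mem_nhdsWithin (s := Set.Ioi 0)).and (hev.filter_mono inf_le_left)).exists

theorem tendsto_iInf_div [l.NeBot] (hd : 0 < d) (hD : 0 < D)
    (hT : ∀ ε > 0, ∀ᶠ n in l, ∀ x, |T n x - d| ≤ ε)
    (hpos : ∀ᶠ n in l, ∀ x, 0 < s n x)
    (hlt : ∀ a > D, ∀ᶠ n in l, ∀ x, s n x < a)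
    (hex : ∀ a < D, ∀ᶠ n in l, ∃ x, a < s n x) :
    Tendsto (fun n => ⨅ x, T n x / s n x) l (𝓝 (d / D)) := by
  have : Nonempty X := (hex (D - 1) (by linarith)).exists.choose_spec.nonempty
  have hbound {ε : ℝ} (hε : 0 < ε) (hεd : ε < d) :
      ∀ᶠ n in l, ∀ x, (d - ε) / (D + ε) ≤ T n x / s n x := by
    filter_upwards [hT ε hε, hpos, hlt (D + ε) (by linarith)] with n hTn hposn hltn x
    have := (abs_le.1 (hTn x)).1
    exact div_le_div₀ (by linarith) (by linarith) (hposn x) (hltn x).le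
  refine tendsto_order.2 ⟨fun a ha => ?_, fun a ha => ?_⟩
  · obtain ⟨ε, hε, hεd, haε⟩ := exists_pos_lt_sub_div_add hd hD ha
    filter_upwards [hbound hε hεd] with n hn
    exact haε.trans_le (le_ciInf hn)
  · obtain ⟨ε, hε, hεD, haε⟩ := exists_pos_add_div_sub_lt hD ha
    filter_upwards [hT ε hε, hex (D - ε) (by linarith), hbound (half_pos hd) (half_lt_self hd)]
      with n hTn ⟨x, hx⟩ hbdd
    have := (abs_le.1 (hTn x)).2
    exact ((ciInf_le ⟨_, Set.forall_mem_range.2 hbdd⟩ x).trans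
      (div_le_div₀ (by linarith) (by linarith) (by linarith) hx.le)).trans_lt haε

theorem tendsto_iSup_div [l.NeBot] (hd : 0 < d) (hD : 0 < D)
    (hT : ∀ ε > 0, ∀ᶠ n in l, ∀ x, |T n x - d| ≤ ε)
    (hgt : ∀ a < D, ∀ᶠ n in l, ∀ x, a < s n x)
    (hex : ∀ a > D, ∀ᶠ n in l, ∃ x, s n x < a) :
    Tendsto (fun n => ⨆ x, T n x / s n x) l (𝓝 (d / D)) := by
  have : Nonempty X := (hex (D + 1) (by linarith)).exists.choose_spec.nonempty
  have hbound {ε : ℝ} (hε : 0 < ε) (hεD : ε < D) :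
      ∀ᶠ n in l, ∀ x, T n x / s n x ≤ (d + ε) / (D - ε) := by
    filter_upwards [hT ε hε, hgt (D - ε) (by linarith)] with n hTn hgtn x
    have := (abs_le.1 (hTn x)).2
    exact div_le_div₀ (by linarith) (by linarith) (by linarith) (hgtn x).le
  refine tendsto_order.2 ⟨fun a ha => ?_, fun a ha => ?_⟩
  · obtain ⟨ε, hε, hεd, haε⟩ := exists_pos_lt_sub_div_add hd hD ha
    filter_upwards [hT ε hε, hgt 0 hD, hex (D + ε) (by linarith),
      hbound (half_pos hD) (half_lt_self hD)] with n hTn hpos ⟨x, hx⟩ hbdd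
    have := (abs_le.1 (hTn x)).1
    exact haε.trans_le ((div_le_div₀ (by linarith) (by linarith) (hpos x) hx.le).trans
      (le_ciSup ⟨_, Set.forall_mem_range.2 hbdd⟩ x))
  · obtain ⟨ε, hε, hεD, haε⟩ := exists_pos_add_div_sub_lt hD ha
    filter_upwards [hbound hε hεD] with n hn
    exact (ciSup_le hn).trans_lt haε

theorem eventually_forall_lt_of_tendsto_iSup_ofReal {D : ℝ≥0}
    (h : Tendsto (fun n => ⨆ x, ENNReal.ofReal (s n x)) l (𝓝 D)) {a : ℝ} (ha : D < a) :
    ∀ᶠ n in l, ∀ x, s n x < a := by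
  rw [← ENNReal.ofReal_coe_nnreal] at h
  filter_upwards [h.eventually_lt_const
    ((ENNReal.ofReal_lt_ofReal_iff_of_nonneg D.coe_nonneg).2 ha)] with n hn x
  exact (ENNReal.ofReal_lt_ofReal_iff'.1 ((le_iSup _ x).trans_lt hn)).1

theorem eventually_exists_lt_of_tendsto_iSup_ofReal {D : ℝ≥0} (hD : 0 < D)
    (h : Tendsto (fun n => ⨆ x, ENNReal.ofReal (s n x)) l (𝓝 D)) {a : ℝ} (ha : a < D) :
    ∀ᶠ n in l, ∃ x, a < s n x := by
  rw [← ENNReal.ofReal_coe_nnreal] at h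
  filter_upwards [h.eventually_const_lt ((ENNReal.ofReal_lt_ofReal_iff hD).2 ha)] with n hn
  obtain ⟨x, hx⟩ := lt_iSup_iff.1 hn
  exact ⟨x, (ENNReal.ofReal_lt_ofReal_iff'.1 hx).1⟩

theorem eventually_forall_lt_of_tendsto_iInf_ofReal {D : ℝ≥0} (hD : 0 < D)
    (h : Tendsto (fun n => ⨅ x, ENNReal.ofReal (s n x)) l (𝓝 D)) {a : ℝ} (ha : a < D) :
    ∀ᶠ n in l, ∀ x, a < s n x := by
  rw [← ENNReal.ofReal_coe_nnreal] at h
  filter_upwards [h.eventually_const_lt ((ENNReal.ofReal_lt_ofReal_iff hD).2 ha)] with n hn x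
  exact (ENNReal.ofReal_lt_ofReal_iff'.1 (hn.trans_le (iInf_le _ x))).1

theorem eventually_exists_lt_of_tendsto_iInf_ofReal {D : ℝ≥0}
    (h : Tendsto (fun n => ⨅ x, ENNReal.ofReal (s n x)) l (𝓝 D)) {a : ℝ} (ha : D < a) :
    ∀ᶠ n in l, ∃ x, s n x < a := by
  rw [← ENNReal.ofReal_coe_nnreal] at h
  filter_upwards [h.eventually_lt_const
    ((ENNReal.ofReal_lt_ofReal_iff_of_nonneg D.coe_nonneg).2 ha)] with n hn
  obtain ⟨x, hx⟩ := iInf_lt_iff.1 hn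
  exact ⟨x, (ENNReal.ofReal_lt_ofReal_iff'.1 hx).1⟩

end UniformQuotients

section FolnerAsymptotics

variable {G : Type*} [Group G] [TopologicalSpace G] [MeasurableSpace G] {μ : Measure G} {Λ : Set G}
  {K : ℕ → Set G}

theorem IsFolner.measureReal_pos [IsFiniteMeasureOnCompacts μ] (hK : IsFolner μ K) (n : ℕ) :
    0 < μ.real (K n) :=
  ENNReal.toReal_pos (hK.measure_ne_zero n) (hK.isCompact n).measure_ne_top

theorem IsRelativelySeparated.encard_div_eq_ofReal [ContinuousMul G] [IsFiniteMeasureOnCompacts μ]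
    (hΛ : IsRelativelySeparated Λ) (hK : IsFolner μ K) (n : ℕ) (x : G) :
    ((Λ ∩ x • K n).encard : ℝ≥0∞) / μ (K n)
      = ENNReal.ofReal ((Λ ∩ x • K n).ncard / μ.real (K n)) := by
  rw [ENNReal.ofReal_div_of_pos (hK.measureReal_pos n), ENNReal.ofReal_natCast, Measure.real,
    ENNReal.ofReal_toReal (hK.isCompact n).measure_ne_top,
    ← (hΛ.finite_inter ((hK.isCompact n).smul x)).cast_ncard_eq, ENat.toENNReal_coe]

variable [IsTopologicalGroup G] [BorelSpace G] [T2Space G] [SigmaCompactSpace G]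
  [μ.IsHaarMeasure] [μ.IsInvInvariant]

theorem IsRelativelySeparated.exists_ncard_inter_le (hΛ : IsRelativelySeparated Λ) (μ : Measure G)
    [μ.IsHaarMeasure] [μ.IsInvInvariant] :
    ∃ U ∈ 𝓝 (1 : G), IsCompact U ∧ ∃ κ ≥ 0, ∀ (S : Set G) (x : G), μ (S * U) ≠ ∞ →
      ((Λ ∩ x • S).ncard : ℝ) ≤ κ * μ.real (S * U) := by
  obtain ⟨U, hU, hUc, N, hN⟩ := id hΛ
  refine ⟨U⁻¹, inv_mem_nhds_one G hU, hUc.inv, N / μ.real U, by positivity, fun S x hSU => ?_⟩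
  have hU0 : 0 < μ.real U :=
    ENNReal.toReal_pos (Measure.measure_pos_of_mem_nhds μ hU).ne' hUc.measure_ne_top
  have hsup : ⨆ y : G, ((Λ ∩ y • U).encard : ℝ≥0∞) ≤ N := iSup_le fun y => by
    exact_mod_cast hN y
  have hncard : ((Λ ∩ x • S).ncard : ℝ≥0∞) ≤ (Λ ∩ x • S).encard := by
    exact_mod_cast Set.ncard_le_encard (Λ ∩ x • S)
  have hcount : ((Λ ∩ x • S).ncard : ℝ≥0∞) * μ U ≤ N * μ (S * U⁻¹) :=
    calc ((Λ ∩ x • S).ncard : ℝ≥0∞) * μ U ≤ (Λ ∩ x • S).encard * μ U := by gcongr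
      _ ≤ μ (S * U⁻¹) * ⨆ y : G, ((Λ ∩ y • U).encard : ℝ≥0∞) :=
        encard_inter_mul_le μ hΛ.countable S hUc x
      _ ≤ N * μ (S * U⁻¹) := by rw [mul_comm]; gcongr
  have hreal := ENNReal.toReal_mono (by finiteness) hcount
  rw [ENNReal.toReal_mul, ENNReal.toReal_mul, ENNReal.toReal_natCast, ENNReal.toReal_natCast]
    at hreal
  rwa [div_mul_eq_mul_div, le_div_iff₀ hU0]

theorem IsStrongFolner.eventually_boundary_le (hK : IsStrongFolner μ K)
    (hΛ : IsRelativelySeparated Λ) {C : Set G} (hC : IsCompact C) {δ : ℝ} (hδ : 0 < δ) :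
    ∀ᶠ n in atTop, ∀ x : G, (Λ ∩ innerBoundary (x • K n) C).ncard
      + μ.real (innerBoundary (x • K n) C) ≤ δ * μ.real (K n) := by
  obtain ⟨U, hU, hUc, κ, hκ, hcount⟩ := hΛ.exists_ncard_inter_le μ
  have hδκ : 0 < δ / (κ + 1) := by positivity
  filter_upwards [(hK.tendsto_innerBoundary_mul hC hUc).eventually_lt_const
    (ENNReal.ofReal_pos.2 hδκ)] with n hn x
  set S := innerBoundary (K n) C
  have hStop : μ (S * U) ≠ ∞ :=
    ((measure_mono (Set.mul_subset_mul_right (innerBoundary_subset _ _))).trans_lt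
      ((hK.isCompact n).mul hUc).measure_lt_top).ne
  have hSU : μ.real (S * U) ≤ δ / (κ + 1) * μ.real (K n) := by
    rw [← div_le_iff₀ (hK.measureReal_pos n), Measure.real, Measure.real, ← ENNReal.toReal_div]
    exact ENNReal.toReal_le_of_le_ofReal hδκ.le hn.le
  have hS : μ.real S ≤ μ.real (S * U) :=
    measureReal_mono (Set.subset_mul_left S (mem_of_mem_nhds hU)) hStop
  rw [← smul_innerBoundary, measureReal_def μ (x • S), measure_smul, ← measureReal_def]
  calc ((Λ ∩ x • S).ncard : ℝ) + μ.real S ≤ κ * μ.real (S * U) + μ.real (S * U) := by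
        gcongr; exact hcount S x hStop
    _ = (κ + 1) * μ.real (S * U) := by ring
    _ ≤ (κ + 1) * (δ / (κ + 1) * μ.real (K n)) := by gcongr
    _ = δ * μ.real (K n) := by field_simp

theorem IsStrongFolner.exists_eventually_ncard_le (hK : IsStrongFolner μ K)
    (hΛ : IsRelativelySeparated Λ) :
    ∃ κ : ℝ, 0 ≤ κ ∧ ∀ᶠ n in atTop, ∀ x : G, (Λ ∩ x • K n).ncard ≤ κ * μ.real (K n) := by
  have hlim := hasUpperBeurlingDensity_upperDensity μ hΛ.countable K hK
  rw [← ENNReal.coe_toNNReal (hΛ.upperDensity_lt_top μ).ne] at hlim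
  simp only [hΛ.encard_div_eq_ofReal hK.toIsFolner] at hlim
  refine ⟨(upperDensity μ Λ).toNNReal + 1, by positivity, ?_⟩
  filter_upwards [eventually_forall_lt_of_tendsto_iSup_ofReal hlim (lt_add_one _)] with n hn x
  exact ((div_lt_iff₀ (hK.measureReal_pos n)).1 (hn x)).le

theorem IsRelativelySeparated.exists_beurlingDensities [LocallyCompactSpace G]
    (hΛ : IsRelativelySeparated Λ) (hΛ' : IsRelativelyDense Λ) (hK : IsStrongFolner μ K) :
    ∃ Dlow Dup : ℝ≥0, 0 < Dlow ∧ Dlow ≤ Dup ∧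
      HasLowerBeurlingDensity μ Λ Dlow ∧ HasUpperBeurlingDensity μ Λ Dup := by
  have hlow := hasLowerBeurlingDensity_lowerDensity μ hΛ.countable
  have hup := hasUpperBeurlingDensity_upperDensity μ hΛ.countable
  have hle : lowerDensity μ Λ ≤ upperDensity μ Λ :=
    le_of_tendsto_of_tendsto' (hlow K hK) (hup K hK) fun n => iInf_le_iSup
  have hpos := hΛ'.lowerDensity_pos μ
  lift upperDensity μ Λ to ℝ≥0 using (hΛ.upperDensity_lt_top μ).ne with Dup
  lift lowerDensity μ Λ to ℝ≥0 using ne_top_of_le_ne_top ENNReal.coe_ne_top hle with Dlow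
  exact ⟨Dlow, Dup, by exact_mod_cast hpos, by exact_mod_cast hle, hlow, hup⟩

end FolnerAsymptotics

section FrameMeasure

variable {G H : Type*} [Group G] [TopologicalSpace G] [IsTopologicalGroup G] [T2Space G]
  [LocallyCompactSpace G] [SecondCountableTopology G] [MeasurableSpace G] [BorelSpace G]
  {μ : Measure G} [μ.IsHaarMeasure] [μ.IsInvInvariant]
  [NormedAddCommGroup H] [InnerProductSpace ℂ H] {π : ProjectiveRep G H} {K : ℕ → Set G}
  {Λ : Set G} {g : H} {d : ℝ}

namespace ProjectiveRep

theorem IsFormalDegree.eventually_abs_finsum_re_inner_div_sub_le (hd : π.IsFormalDegree μ d)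
    (hK : IsStrongFolner μ K) (hΛ : IsRelativelySeparated Λ) (htail : π.HasUniformTails Λ g)
    (hg : g ≠ 0) {h : Λ → H} {b b' : ℝ≥0} (he : IsBesselWith (π.coherentSystem Λ g) b)
    (hh : IsBesselWith h b') (hdual : IsDualFamily (π.coherentSystem Λ g) h)
    {ε : ℝ} (hε : 0 < ε) :
    ∀ᶠ n in atTop, ∀ x : G, |(∑ᶠ (l : Λ) (_ : (l : G) ∈ x • K n), (inner ℂ (h l) (π l g)).re)
      / μ.real (K n) - d| ≤ ε := by
  obtain ⟨X, hX, hsum⟩ := hd.exists_abs_sum_re_inner_sub_le he hh hdual hg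
  obtain ⟨κ, hκ, hcount⟩ := hK.exists_eventually_ncard_le hΛ
  set η := ε / (2 * (X + 1) * (κ + 1))
  set δ := ε / (2 * (X + 1))
  have hη : 0 < η := by positivity
  obtain ⟨C, hC, hloc⟩ := htail.exists_isLocalizedBy (hd.memLp_coeff g) hη
  filter_upwards [hcount, hK.eventually_boundary_le hΛ hC.inv (δ := δ) (by positivity)]
    with n hcountn hbdn x
  have hcompact : IsCompact (x • K n) := (hK.isCompact n).smul x
  have hfin : (Subtype.val ⁻¹' (x • K n) : Set Λ).Finite := by
    rw [← Subtype.preimage_coe_self_inter]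
    exact (hΛ.finite_inter hcompact).preimage Subtype.val_injective.injOn
  have hfinsum : ∑ᶠ (l : Λ) (_ : (l : G) ∈ x • K n), (inner ℂ (h l) (π l g)).re
      = ∑ l ∈ hfin.toFinset, (inner ℂ (h l) (π l g)).re := finsum_mem_eq_finite_toFinset_sum _ hfin
  have hm : μ.real (x • K n) = μ.real (K n) := by
    rw [measureReal_def, measure_smul, ← measureReal_def]
  have hm0 := hK.measureReal_pos n
  have hmain := hsum hloc hη.le hcompact.measurableSet hcompact.measure_ne_top
    (measurableSet_innerBoundary hcompact.isClosed _) (t := hfin.toFinset) fun l => by simp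
  rw [hm] at hmain
  rw [hfinsum, div_sub' hm0.ne', abs_div, abs_of_pos hm0, div_le_iff₀ hm0, mul_comm _ d]
  calc |∑ l ∈ hfin.toFinset, (inner ℂ (h l) (π l g)).re - d * μ.real (K n)|
      ≤ X * (η * (κ * μ.real (K n) + μ.real (K n)) + δ * μ.real (K n)) := by
        refine hmain.trans ?_
        gcongr
        · exact hcountn x
        · exact hbdn x
    _ = X / (X + 1) * (ε * μ.real (K n)) := by
        simp only [η, δ]
        field_simp
        ring
    _ ≤ ε * μ.real (K n) :=
        mul_le_of_le_one_left (by positivity) ((div_le_one (by positivity)).2 (by linarith))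

theorem IsFormalDegree.hasFrameMeasures [CompleteSpace H] (hd : π.IsFormalDegree μ d)
    (hK : IsStrongFolner μ K) (hΛ : IsRelativelySeparated Λ) (htail : π.HasUniformTails Λ g)
    (hg : g ≠ 0) (hframe : IsFrame (π.coherentSystem Λ g)) {Dlow Dup : ℝ≥0} (hlow0 : 0 < Dlow)
    (hup0 : 0 < Dup) (hlow : HasLowerBeurlingDensity μ Λ Dlow)
    (hup : HasUpperBeurlingDensity μ Λ Dup) :
    π.HasLowerFrameMeasure Λ g K (d / Dup) ∧ π.HasUpperFrameMeasure Λ g K (d / Dlow) := by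
  obtain ⟨b, he⟩ := hframe.exists_isBesselWith
  obtain ⟨b', hh⟩ := hframe.exists_isBesselWith_canonicalDual
  have hsum := fun ε (hε : ε > 0) => hd.eventually_abs_finsum_re_inner_div_sub_le hK hΛ htail hg he
    hh hframe.isDualFamily_canonicalDual hε
  have hlow := hlow K hK
  have hup := hup K hK
  simp only [hΛ.encard_div_eq_ofReal hK.toIsFolner] at hlow hup
  have haverage (n : ℕ) (x : G) : π.frameAverage Λ g (x • K n)
      = (∑ᶠ (l : Λ) (_ : (l : G) ∈ x • K n),
          (inner ℂ (canonicalDual (π.coherentSystem Λ g) l) (π l g)).re) / μ.real (K n)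
        / ((Λ ∩ x • K n).ncard / μ.real (K n)) :=
    (div_div_div_cancel_right₀ (hK.measureReal_pos n).ne' _ _).symm
  simp only [HasLowerFrameMeasure, HasUpperFrameMeasure, haverage]
  exact ⟨tendsto_iInf_div hd.1 hup0 hsum
      (eventually_forall_lt_of_tendsto_iInf_ofReal hlow0 hlow hlow0)
      (fun _ => eventually_forall_lt_of_tendsto_iSup_ofReal hup)
      fun _ => eventually_exists_lt_of_tendsto_iSup_ofReal hup0 hup,
    tendsto_iSup_div hd.1 hlow0 hsum
      (fun _ => eventually_forall_lt_of_tendsto_iInf_ofReal hlow0 hlow)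
      fun _ => eventually_exists_lt_of_tendsto_iInf_ofReal hlow⟩

end ProjectiveRep

end FrameMeasure

end CoherentFrame

theorem theorem3p2_general
    {G : Type*} [Group G] [TopologicalSpace G] [IsTopologicalGroup G] [T2Space G]
    [LocallyCompactSpace G] [SecondCountableTopology G] [MeasurableSpace G] [BorelSpace G]
    (μ : Measure G) [μ.IsHaarMeasure] [μ.IsMulRightInvariant]
    {H : Type*} [NormedAddCommGroup H] [InnerProductSpace ℂ H] [CompleteSpace H]
    (π : CoherentFrame.ProjectiveRep G H) (hπ : π.IsDiscreteSeries μ)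
    (Q : Set G) (hQn : Q ∈ 𝓝 (1 : G))
    (K : ℕ → Set G) (hK : CoherentFrame.IsStrongFolner μ K)
    (Λ : Set G) (g : H) (hg : π.MemB2 μ Q g)
    (hframe : CoherentFrame.IsFrame (π.coherentSystem Λ g)) :
    ∃ d : ℝ, π.IsFormalDegree μ d ∧
      ∃ Dlow Dup : ℝ≥0, 0 < Dlow ∧ Dlow ≤ Dup ∧
        CoherentFrame.HasLowerBeurlingDensity μ Λ Dlow ∧
        CoherentFrame.HasUpperBeurlingDensity μ Λ Dup ∧
        π.HasLowerFrameMeasure Λ g K (d / Dup) ∧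
        π.HasUpperFrameMeasure Λ g K (d / Dlow) := by
  have := CoherentFrame.isInvInvariant_of_isMulRightInvariant μ
  obtain ⟨d, hd⟩ := hπ.exists_isFormalDegree
  have : Nontrivial H := let ⟨u, hu, _⟩ := hπ.2; nontrivial_of_ne u 0 hu
  have hg0 : g ≠ 0 := by
    obtain ⟨l, hl⟩ := hframe.exists_ne_zero
    rintro rfl
    exact hl (map_zero _)
  obtain ⟨_, hbessel⟩ := hframe.exists_isBesselWith
  obtain ⟨_, hbessel'⟩ := hframe.exists_isBesselWith_canonicalDual
  have hsep := CoherentFrame.ProjectiveRep.isRelativelySeparated_of_isBesselWith hbessel hg0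
  have htail := hg.hasUniformTails hQn hsep
  have hdense := htail.isRelativelyDense hbessel' hframe.isDualFamily_canonicalDual hg0
  obtain ⟨Dlow, Dup, hpos, hle, hlow, hup⟩ := hsep.exists_beurlingDensities hdense hK
  exact ⟨d, hd, Dlow, Dup, hpos, hle, hlow, hup,
    hd.hasFrameMeasures hK hsep htail hg0 hframe hpos (hpos.trans_le hle) hlow hup⟩

theorem theorem3p2
    {G : Type*} [Group G] [TopologicalSpace G] [IsTopologicalGroup G] [T2Space G]
    [LocallyCompactSpace G] [SecondCountableTopology G] [MeasurableSpace G] [BorelSpace G]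
    (μ : Measure G) [μ.IsHaarMeasure] [μ.IsMulRightInvariant]
    {H : Type*} [NormedAddCommGroup H] [InnerProductSpace ℂ H] [CompleteSpace H]
    (π : CoherentFrame.ProjectiveRep G H) (hπ : π.IsDiscreteSeries μ)
    (Q : Set G) (hQc : IsCompact Q) (hQs : Q⁻¹ = Q) (hQn : Q ∈ 𝓝 (1 : G))
    (K : ℕ → Set G) (hK : CoherentFrame.IsStrongFolner μ K)
    (hKc : CoherentFrame.IsNestedCover K)
    (Λ : Set G) (hΛ : DiscreteTopology Λ)
    (g : H) (hg : π.MemB2 μ Q g)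
    (hframe : CoherentFrame.IsFrame (π.coherentSystem Λ g)) :
    ∃ d : ℝ, π.IsFormalDegree μ d ∧
      ∃ Dlow Dup : ℝ≥0, 0 < Dlow ∧ Dlow ≤ Dup ∧
        CoherentFrame.HasLowerBeurlingDensity μ Λ Dlow ∧
        CoherentFrame.HasUpperBeurlingDensity μ Λ Dup ∧
        π.HasLowerFrameMeasure Λ g K (d / Dup) ∧
        π.HasUpperFrameMeasure Λ g K (d / Dlow) :=
  theorem3p2_general μ π hπ Q hQn K hK Λ g hg hframe
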